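/- Let $X$ be a topological space (for instance a smooth manifold), let $K(X)$ be the Grothendieck ring of complex vector bundles on $X$ (sum induced by $\oplus$, product by $\otimes$), and let $E$ be a complex vector bundle on $X$ and $n\ge 1$. If a finite group $G$ acts trivially on $X$ and $V$ is a complex $G$-vector bundle on $X$, then for $g\in G$ the bundle $V$ is the direct sum of the subbundles $V_\xi$ of eigenspaces of $g$, and the $g$-component of the Atiyah–Segal map is $$\phi_g(V)=\sum_{\xi}\xi\,[V_\xi]\in \mathbb C\otimes K(X),$$ the sum being over the eigenvalues $\xi$ of $g$. Let the symmetric group $S_n$ act on $E^{\otimes n}$ by $\sigma(v_1\otimes\cdots\otimes v_n)=v_{\sigma^{-1}(1)}\otimes\cdots\otimes v_{\sigma^{-1}(n)}$, and let $\sigma_n\in S_n$ be the $n$-cycle $1\mapsto 2\mapsto\cdots\mapsto n\mapsto 1$. Let $\psi^n(E)\in K(X)$ be the $n$-th Adams operation, i.e. $\psi^n(E)=N_n([\Lambda^1E],\dots,[\Lambda^nE])$, where $N_n$ is the $n$-th Newton polynomial, which expresses the power sum $\sum_i x_i^n$ through the elementary symmetric functions of the $x_i$. Then $$\phi_{\sigma_n}(E^{\otimes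 n})=\psi^n(E)\quad\text{in }\mathbb C\otimes K(X).$$ Moreover, if $E\cong L_1\oplus\cdots\oplus L_r$ with line bundles $L_1,\dots,L_r$, then $\psi^n(E)=\sum_{m=1}^r[L_m^{\otimes n}]$ in $K(X)$. -/

import Mathlib

open scoped TensorProduct

universe u v

noncomputable section

/-- A complex vector bundle on a topological space `X`: finite-dimensional complex vector spaces
`fiber x`, together with a vector bundle atlas.  Around every point `x` there is a chart with open
domain `dom x`, given by a local frame `frame x y` of the fibres `fiber y`, `y ∈ dom x`, and by the
coordinate functions `coord x y` of that frame; the transition functions between any two charts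
are continuous.  The rank may vary from one connected component to another.  (The values of `frame`
and `coord` outside of `dom x` are irrelevant.) -/
structure VecBundle (X : Type u) [TopologicalSpace X] where
  fiber : X → Type v
  [addCommGroup : ∀ x, AddCommGroup (fiber x)]
  [module : ∀ x, Module ℂ (fiber x)]
  dom : X → Set X
  isOpen_dom : ∀ x, IsOpen (dom x)
  mem_dom : ∀ x, x ∈ dom x
  idx : X → Type
  [fintype : ∀ x, Fintype (idx x)]
  [decEq : ∀ x, DecidableEq (idx x)]
  frame : ∀ x y, idx x → fiber y
  coord : ∀ x y, idx x → fiber y →ₗ[ℂ] ℂ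
  coord_frame : ∀ x, ∀ y ∈ dom x, ∀ i j, coord x y i (frame x y j) = if i = j then 1 else 0
  sum_coord_smul_frame : ∀ x, ∀ y ∈ dom x, ∀ v : fiber y, ∑ i, coord x y i v • frame x y i = v
  continuousOn_transition : ∀ x x' i j,
    ContinuousOn (fun y => coord x y i (frame x' y j)) (dom x ∩ dom x')

namespace VecBundle

variable {X : Type u} [TopologicalSpace X]

attribute [instance] VecBundle.addCommGroup VecBundle.module VecBundle.fintype VecBundle.decEq

/-! ### Morphisms and isomorphisms -/

/-- A family of linear maps between the fibres of two bundles is continuous (that is, a morphism of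
vector bundles) if its matrix entries with respect to the charts are continuous. -/
def IsContHom (E F : VecBundle.{u, v} X) (f : ∀ x, E.fiber x →ₗ[ℂ] F.fiber x) : Prop :=
  ∀ x x' i j, ContinuousOn (fun y => F.coord x' y i (f y (E.frame x y j))) (E.dom x ∩ F.dom x')

/-- Two bundles over `X` are isomorphic: there is a continuous family of linear isomorphisms of the
fibres, with continuous inverse. -/
def IsIso (E F : VecBundle.{u, v} X) : Prop :=
  ∃ f : ∀ x, E.fiber x ≃ₗ[ℂ] F.fiber x,
    IsContHom E F (fun x => (f x).toLinearMap) ∧ IsContHom F E (fun x => (f x).symm.toLinearMap)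

theorem isContHom_id (E : VecBundle.{u, v} X) : IsContHom E E (fun _ => LinearMap.id) := by
  intro x x' i j
  rw [Set.inter_comm]
  exact E.continuousOn_transition x' x i j

theorem IsContHom.comp {E F G : VecBundle.{u, v} X} {g : ∀ x, F.fiber x →ₗ[ℂ] G.fiber x}
    {f : ∀ x, E.fiber x →ₗ[ℂ] F.fiber x} (hg : IsContHom F G g) (hf : IsContHom E F f) :
    IsContHom E G (fun x => g x ∘ₗ f x) := by
  intro x x' i j y₀ hy₀
  have hopen : IsOpen (E.dom x ∩ G.dom x') := (E.isOpen_dom x).inter (G.isOpen_dom x')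
  have hU : F.dom y₀ ∩ (E.dom x ∩ G.dom x') ∈ nhds y₀ :=
    ((F.isOpen_dom y₀).inter hopen).mem_nhds ⟨F.mem_dom y₀, hy₀⟩
  apply ContinuousAt.continuousWithinAt
  have key : ContinuousOn (fun y => ∑ k, F.coord y₀ y k (f y (E.frame x y j)) *
      G.coord x' y i (g y (F.frame y₀ y k))) (F.dom y₀ ∩ (E.dom x ∩ G.dom x')) := by
    refine continuousOn_finsetSum _ fun k _ => ContinuousOn.mul ?_ ?_
    · exact (hf x y₀ k j).mono fun y hy => ⟨hy.2.1, hy.1⟩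
    · exact (hg y₀ x' i k).mono fun y hy => ⟨hy.1, hy.2.2⟩
  refine (key.congr ?_).continuousAt hU
  intro y hy
  have h := F.sum_coord_smul_frame y₀ y hy.1 (f y (E.frame x y j))
  simp only [LinearMap.comp_apply]
  conv_lhs => rw [← h]
  simp [map_sum]

theorem IsContHom.add {E F : VecBundle.{u, v} X} {f g : ∀ x, E.fiber x →ₗ[ℂ] F.fiber x}
    (hf : IsContHom E F f) (hg : IsContHom E F g) : IsContHom E F (fun x => f x + g x) := by
  intro x x' i j
  simp only [LinearMap.add_apply, map_add]
  exact (hf x x' i j).add (hg x x' i j)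

theorem isContHom_zero (E F : VecBundle.{u, v} X) : IsContHom E F (fun _ => 0) := by
  intro x x' i j
  simpa using continuousOn_const

theorem IsContHom.smul {E F : VecBundle.{u, v} X} {f : ∀ x, E.fiber x →ₗ[ℂ] F.fiber x} (c : ℂ)
    (hf : IsContHom E F f) : IsContHom E F (fun x => c • f x) := by
  intro x x' i j
  simp only [LinearMap.smul_apply, map_smul]
  exact (hf x x' i j).const_smul c

/-- A family of linear maps that carries local frames to local frames is continuous. -/
theorem isContHom_of_frame {E F : VecBundle.{u, v} X} (f : ∀ x, E.fiber x →ₗ[ℂ] F.fiber x)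
    (φ : ∀ x, E.idx x → F.idx x) (hdom : ∀ x, E.dom x ⊆ F.dom x)
    (h : ∀ x, ∀ y ∈ E.dom x, ∀ j, f y (E.frame x y j) = F.frame x y (φ x j)) :
    IsContHom E F f := by
  intro x x' i j
  refine ((F.continuousOn_transition x' x i (φ x j)).mono ?_).congr ?_
  · exact fun y hy => ⟨hy.2, hdom x hy.1⟩
  · intro y hy
    simp only [h x y hy.1 j]

theorem isIso_of_frame {E F : VecBundle.{u, v} X} (f : ∀ x, E.fiber x ≃ₗ[ℂ] F.fiber x)
    (φ : ∀ x, E.idx x ≃ F.idx x) (hdom : ∀ x, E.dom x = F.dom x)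
    (h : ∀ x, ∀ y ∈ E.dom x, ∀ j, f y (E.frame x y j) = F.frame x y (φ x j)) :
    IsIso E F := by
  refine ⟨f, isContHom_of_frame _ (fun x => φ x) (fun x => (hdom x).le) h,
    isContHom_of_frame _ (fun x => (φ x).symm) (fun x => (hdom x).ge) ?_⟩
  intro x y hy j
  rw [LinearEquiv.coe_coe, LinearEquiv.symm_apply_eq, h x y ((hdom x).ge hy)]
  simp

theorem IsIso.refl (E : VecBundle.{u, v} X) : IsIso E E :=
  ⟨fun _ => LinearEquiv.refl ℂ _, isContHom_id E, isContHom_id E⟩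

theorem IsIso.symm {E F : VecBundle.{u, v} X} : IsIso E F → IsIso F E := by
  rintro ⟨f, hf, hf'⟩
  exact ⟨fun x => (f x).symm, hf', hf⟩

theorem IsIso.trans {E F G : VecBundle.{u, v} X} : IsIso E F → IsIso F G → IsIso E G := by
  rintro ⟨f, hf, hf'⟩ ⟨g, hg, hg'⟩
  exact ⟨fun x => (f x).trans (g x), hg.comp hf, hf'.comp hg'⟩

/-! ### Direct sums, tensor products, tensor powers, exterior powers -/

/-- The zero bundle. -/
def zero (X : Type u) [TopologicalSpace X] : VecBundle.{u, v} X where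
  fiber _ := PUnit.{v + 1}
  dom _ := Set.univ
  isOpen_dom _ := isOpen_univ
  mem_dom _ := trivial
  idx _ := Empty
  frame _ _ i := i.elim
  coord _ _ i := i.elim
  coord_frame _ _ _ i := i.elim
  sum_coord_smul_frame _ _ _ _ := rfl
  continuousOn_transition _ _ i := i.elim

/-- The trivial line bundle. -/
def one (X : Type u) [TopologicalSpace X] : VecBundle.{u, v} X where
  fiber _ := ULift.{v} ℂ
  dom _ := Set.univ
  isOpen_dom _ := isOpen_univ
  mem_dom _ := trivial
  idx _ := Unit
  frame _ _ _ := ULift.up 1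
  coord _ _ _ := (ULift.moduleEquiv (R := ℂ) (M := ℂ)).toLinearMap
  coord_frame _ _ _ i j := by simp
  sum_coord_smul_frame _ _ _ w := by
    ext
    simp
  continuousOn_transition _ _ _ _ := continuousOn_const

/-- The direct sum `E ⊕ F`. -/
def directSum (E F : VecBundle.{u, v} X) : VecBundle.{u, v} X where
  fiber x := E.fiber x × F.fiber x
  dom x := E.dom x ∩ F.dom x
  isOpen_dom x := (E.isOpen_dom x).inter (F.isOpen_dom x)
  mem_dom x := ⟨E.mem_dom x, F.mem_dom x⟩
  idx x := E.idx x ⊕ F.idx x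
  frame x y := Sum.elim (fun i => (E.frame x y i, 0)) (fun i => (0, F.frame x y i))
  coord x y := Sum.elim (fun i => E.coord x y i ∘ₗ LinearMap.fst ℂ _ _)
    (fun i => F.coord x y i ∘ₗ LinearMap.snd ℂ _ _)
  coord_frame x y hy i j := by
    rcases i with i | i <;> rcases j with j | j <;>
      simp [E.coord_frame x y hy.1, F.coord_frame x y hy.2]
  sum_coord_smul_frame x y hy w := by
    have h1 := E.sum_coord_smul_frame x y hy.1 w.1
    have h2 := F.sum_coord_smul_frame x y hy.2 w.2
    ext
    · simpa [Prod.fst_sum] using h1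
    · simpa [Prod.snd_sum] using h2
  continuousOn_transition x x' i j := by
    rcases i with i | i <;> rcases j with j | j
    · exact (E.continuousOn_transition x x' i j).mono fun y hy => ⟨hy.1.1, hy.2.1⟩
    · simpa using continuousOn_const
    · simpa using continuousOn_const
    · exact (F.continuousOn_transition x x' i j).mono fun y hy => ⟨hy.1.2, hy.2.2⟩

/-- The tensor product `E ⊗ F`. -/
def tensor (E F : VecBundle.{u, v} X) : VecBundle.{u, v} X where
  fiber x := E.fiber x ⊗[ℂ] F.fiber x
  dom x := E.dom x ∩ F.dom x
  isOpen_dom x := (E.isOpen_dom x).inter (F.isOpen_dom x)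
  mem_dom x := ⟨E.mem_dom x, F.mem_dom x⟩
  idx x := E.idx x × F.idx x
  frame x y i := E.frame x y i.1 ⊗ₜ F.frame x y i.2
  coord x y i := LinearMap.mul' ℂ ℂ ∘ₗ TensorProduct.map (E.coord x y i.1) (F.coord x y i.2)
  coord_frame x y hy i j := by
    rcases i with ⟨i, i'⟩
    rcases j with ⟨j, j'⟩
    simp only [LinearMap.comp_apply, TensorProduct.map_tmul, LinearMap.mul'_apply,
      E.coord_frame x y hy.1, F.coord_frame x y hy.2, Prod.mk.injEq]
    split_ifs <;> simp_all
  sum_coord_smul_frame x y hy w := by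
    induction w using TensorProduct.induction_on with
    | zero => simp
    | add a b ha hb => simp only [map_add, add_smul, Finset.sum_add_distrib, ha, hb]
    | tmul a b =>
      conv_rhs => rw [← E.sum_coord_smul_frame x y hy.1 a, ← F.sum_coord_smul_frame x y hy.2 b]
      rw [TensorProduct.sum_tmul, Fintype.sum_prod_type]
      refine Finset.sum_congr rfl fun i _ => ?_
      rw [TensorProduct.tmul_sum]
      refine Finset.sum_congr rfl fun j _ => ?_
      simp only [LinearMap.comp_apply, TensorProduct.map_tmul, LinearMap.mul'_apply,
        TensorProduct.smul_tmul_smul]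
  continuousOn_transition x x' i j := by
    refine ContinuousOn.congr (ContinuousOn.mul
      ((E.continuousOn_transition x x' i.1 j.1).mono ?_)
      ((F.continuousOn_transition x x' i.2 j.2).mono ?_)) (g := _) (f := _) ?_
    · exact fun y hy => ⟨hy.1.1, hy.2.1⟩
    · exact fun y hy => ⟨hy.1.2, hy.2.2⟩
    · intro y _
      simp

/-- The tensor power `E^{⊗ n}`. -/
def tensorPower (E : VecBundle.{u, v} X) (n : ℕ) : VecBundle.{u, v} X where
  fiber x := ⨂[ℂ] _ : Fin n, E.fiber x
  dom := E.dom
  isOpen_dom := E.isOpen_dom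
  mem_dom := E.mem_dom
  idx x := Fin n → E.idx x
  frame x y i := PiTensorProduct.tprod ℂ fun k => E.frame x y (i k)
  coord x y i := PiTensorProduct.lift
    ((MultilinearMap.mkPiAlgebra ℂ (Fin n) ℂ).compLinearMap fun k => E.coord x y (i k))
  coord_frame x y hy i j := by
    simp [E.coord_frame x y hy, Finset.prod_ite_zero, funext_iff]
  sum_coord_smul_frame x y hy w := by
    induction w using PiTensorProduct.induction_on with
    | add a b ha hb => simp only [map_add, add_smul, Finset.sum_add_distrib, ha, hb]
    | smul_tprod r a =>
      have h : (PiTensorProduct.tprod ℂ a) = PiTensorProduct.tprod ℂ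
          (fun k => ∑ i, E.coord x y i (a k) • E.frame x y i) := by
        congr 1
        funext k
        exact (E.sum_coord_smul_frame x y hy (a k)).symm
      conv_rhs => rw [h, MultilinearMap.map_sum, Finset.smul_sum]
      refine Finset.sum_congr rfl fun i _ => ?_
      rw [MultilinearMap.map_smul_univ]
      simp [smul_smul]
  continuousOn_transition x x' i j := by
    simp only [PiTensorProduct.lift.tprod, MultilinearMap.compLinearMap_apply,
      MultilinearMap.mkPiAlgebra_apply]
    exact continuousOn_finsetProd _ fun k _ => E.continuousOn_transition x x' (i k) (j k)

/-- The local frame of a chart, as a basis of a fibre over the domain of the chart. -/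
def basis (E : VecBundle.{u, v} X) (x y : X) (hy : y ∈ E.dom x) :
    Module.Basis (E.idx x) ℂ (E.fiber y) :=
  Module.Basis.ofEquivFun
    { toFun := fun w i => E.coord x y i w
      map_add' := fun a b => by
        funext i
        simp
      map_smul' := fun c a => by
        funext i
        simp
      invFun := fun c => ∑ i, c i • E.frame x y i
      left_inv := fun w => E.sum_coord_smul_frame x y hy w
      right_inv := fun c => by
        funext i
        simp [E.coord_frame x y hy] }

theorem basis_repr (E : VecBundle.{u, v} X) (x y : X) (hy : y ∈ E.dom x) (w : E.fiber y)
    (i : E.idx x) : (E.basis x y hy).repr w i = E.coord x y i w := rfl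

theorem basis_apply (E : VecBundle.{u, v} X) (x y : X) (hy : y ∈ E.dom x) (i : E.idx x) :
    E.basis x y hy i = E.frame x y i := by
  rw [← (E.basis x y hy).repr.injective.eq_iff, Module.Basis.repr_self]
  ext j
  rw [basis_repr, E.coord_frame x y hy, Finsupp.single_apply]
  simp only [eq_comm]

theorem coe_basis (E : VecBundle.{u, v} X) (x y : X) (hy : y ∈ E.dom x) :
    ⇑(E.basis x y hy) = E.frame x y :=
  funext (E.basis_apply x y hy)

theorem basis_coord (E : VecBundle.{u, v} X) (x y : X) (hy : y ∈ E.dom x) :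
    (E.basis x y hy).coord = E.coord x y := by
  funext i
  ext w
  exact E.basis_repr x y hy w i

/-- An auxiliary linear order on the index set of a local frame, used to list the increasing
sequences of indices. -/
abbrev idxOrder (I : Type) : LinearOrder I := IsWellOrder.linearOrder WellOrderingRel

/-- The exterior power `Λ^k E`. -/
def extPower (E : VecBundle.{u, v} X) (k : ℕ) : VecBundle.{u, v} X :=
  letI : ∀ x, LinearOrder (E.idx x) := fun x => idxOrder (E.idx x)
  { fiber := fun x => ⋀[ℂ]^k (E.fiber x)
    dom := E.dom
    isOpen_dom := E.isOpen_dom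
    mem_dom := E.mem_dom
    idx := fun x => Set.powersetCard (E.idx x) k
    fintype := fun _ => Fintype.ofFinite _
    decEq := fun _ => Classical.decEq _
    frame := fun x y s => exteriorPower.ιMulti_family ℂ k (E.frame x y) s
    coord := fun x y s => exteriorPower.pairingDual ℂ (E.fiber y) k
      (exteriorPower.ιMulti_family ℂ k (E.coord x y) s)
    coord_frame := by
      intro x y hy s t
      rw [← E.basis_coord x y hy, ← E.coe_basis x y hy]
      change exteriorPower.ιMultiDual ℂ k (E.basis x y hy) s _ = _
      split_ifs with h
      · rw [h, exteriorPower.ιMultiDual_apply_diag]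
      · rw [exteriorPower.ιMultiDual_apply_nondiag _ _ _ _ _ h]
    sum_coord_smul_frame := by
      intro x y hy w
      let _ : Fintype (Set.powersetCard (E.idx x) k) := Fintype.ofFinite _
      rw [← E.basis_coord x y hy, ← E.coe_basis x y hy]
      conv_rhs => rw [← ((E.basis x y hy).exteriorPower k).sum_repr w]
      refine Finset.sum_congr rfl fun s _ => ?_
      rw [exteriorPower.basis_repr_apply, exteriorPower.basis_apply]
      rfl
    continuousOn_transition := by
      intro x x' s t
      simp only [exteriorPower.ιMulti_family, exteriorPower.pairingDual_ιMulti_ιMulti,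
        Matrix.det_apply]
      refine continuousOn_finsetSum _ fun σ _ => ContinuousOn.const_smul ?_ _
      exact continuousOn_finsetProd _ fun k _ => E.continuousOn_transition x x' _ _ }

/-! ### Subbundles -/

namespace Summand

variable (E : VecBundle.{u, v} X) (P : ∀ x, E.fiber x →ₗ[ℂ] E.fiber x)

/-- The matrix of `P` over `y` in the chart at `x`. -/
def mat (x y : X) : Matrix (E.idx x) (E.idx x) ℂ :=
  Matrix.of fun i j => E.coord x y i (P y (E.frame x y j))

/-- A matrix which intertwines the matrices of `P` over `x` and over `y`; it is the identity for
`y = x`. -/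
def twist (x y : X) : Matrix (E.idx x) (E.idx x) ℂ :=
  mat E P x y * mat E P x x + (1 - mat E P x y) * (1 - mat E P x x)

/-- The vector of coordinates. -/
def vec (x y : X) (w : E.fiber y) : E.idx x → ℂ := fun i => E.coord x y i w

/-- The vector with given coordinates. -/
def ofVec (x y : X) (c : E.idx x → ℂ) : E.fiber y := ∑ i, c i • E.frame x y i

variable {E P}

theorem ofVec_vec {x y : X} (hy : y ∈ E.dom x) (w : E.fiber y) : ofVec E x y (vec E x y w) = w :=
  E.sum_coord_smul_frame x y hy w

theorem vec_ofVec {x y : X} (hy : y ∈ E.dom x) (c : E.idx x → ℂ) :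
    vec E x y (ofVec E x y c) = c := by
  funext i
  simp [vec, ofVec, E.coord_frame x y hy]

theorem vec_apply {x y : X} (hy : y ∈ E.dom x) (w : E.fiber y) :
    vec E x y (P y w) = (mat E P x y).mulVec (vec E x y w) := by
  conv_lhs => rw [← ofVec_vec hy w]
  funext i
  simp [vec, ofVec, mat, Matrix.mulVec, dotProduct, mul_comm]

theorem mat_mul_self {W : ∀ x, Submodule ℂ (E.fiber x)} (hP : ∀ x, LinearMap.IsProj (W x) (P x))
    {x y : X} (hy : y ∈ E.dom x) : mat E P x y * mat E P x y = mat E P x y := by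
  apply Matrix.ext_of_mulVec_single
  intro i
  rw [← Matrix.mulVec_mulVec, ← vec_ofVec hy (Pi.single i 1), ← vec_apply hy, ← vec_apply hy,
    (hP y).map_id _ ((hP y).map_mem _)]

theorem twist_self {W : ∀ x, Submodule ℂ (E.fiber x)} (hP : ∀ x, LinearMap.IsProj (W x) (P x))
    (x : X) : twist E P x x = 1 := by
  have h := mat_mul_self hP (E.mem_dom x)
  simp only [twist, mul_sub, sub_mul, h, mul_one, one_mul]
  abel

theorem mat_mul_twist {W : ∀ x, Submodule ℂ (E.fiber x)} (hP : ∀ x, LinearMap.IsProj (W x) (P x))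
    {x y : X} (hy : y ∈ E.dom x) :
    mat E P x y * twist E P x y = twist E P x y * mat E P x x := by
  have h := mat_mul_self hP (E.mem_dom x)
  have h' := mat_mul_self hP hy
  simp only [twist, mul_add, add_mul, mul_sub, sub_mul, ← mul_assoc, h', mul_one, one_mul]
  simp only [mul_assoc, h]
  abel

theorem twist_mulVec {W : ∀ x, Submodule ℂ (E.fiber x)} (hP : ∀ x, LinearMap.IsProj (W x) (P x))
    {x y : X} {c : E.idx x → ℂ} (hc : (mat E P x x).mulVec c = c) :
    (twist E P x y).mulVec c = (mat E P x y).mulVec c := by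
  have h : (twist E P x y).mulVec c = (twist E P x y * mat E P x x).mulVec c := by
    rw [← Matrix.mulVec_mulVec, hc]
  rw [h]
  have h' := mat_mul_self hP (E.mem_dom x)
  have h2 : twist E P x y * mat E P x x = mat E P x y * mat E P x x := by
    simp only [twist, add_mul, sub_mul, mul_sub, mul_assoc, h', mul_one, one_mul]
    abel
  rw [h2, ← Matrix.mulVec_mulVec, hc]

theorem inv_twist_mulVec {W : ∀ x, Submodule ℂ (E.fiber x)}
    (hP : ∀ x, LinearMap.IsProj (W x) (P x)) {x y : X} (hdet : (twist E P x y).det ≠ 0)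
    {c : E.idx x → ℂ} (hc : (mat E P x x).mulVec c = c) :
    (twist E P x y)⁻¹.mulVec ((mat E P x y).mulVec c) = c := by
  rw [← twist_mulVec hP hc, Matrix.mulVec_mulVec, Matrix.nonsing_inv_mul _ hdet.isUnit,
    Matrix.one_mulVec]

theorem continuousOn_mat (hP : IsContHom E E P) (x : X) : ContinuousOn (mat E P x) (E.dom x) := by
  refine continuousOn_pi.2 fun i => continuousOn_pi.2 fun j => ?_
  exact (hP x x i j).mono fun y hy => ⟨hy, hy⟩

theorem continuousOn_twist (hP : IsContHom E E P) (x : X) :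
    ContinuousOn (twist E P x) (E.dom x) := by
  have h := continuousOn_mat hP x
  exact (h.mul continuousOn_const).add ((continuousOn_const.sub h).mul continuousOn_const)

/-- A direct summand of a vector bundle is a vector bundle: near `x`, a basis of the fibre over `x`
is extended to constant vectors in a chart, and projected to the summand. -/
def ofProj (W : ∀ x, Submodule ℂ (E.fiber x)) (hc : IsContHom E E P)
    (hP : ∀ x, LinearMap.IsProj (W x) (P x)) : VecBundle.{u, v} X :=
  haveI : ∀ x, Module.Finite ℂ (E.fiber x) := fun x =>
    Module.Finite.of_basis (E.basis x x (E.mem_dom x))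
  let β : ∀ x, Module.Basis (Fin (Module.finrank ℂ (W x))) ℂ (W x) := fun x =>
    Module.finBasis ℂ (W x)
  { fiber := fun x => W x
    dom := fun x => E.dom x ∩ (fun y => (twist E P x y).det) ⁻¹' {0}ᶜ
    isOpen_dom := fun x => by
      have h : ContinuousOn (fun y => (twist E P x y).det) (E.dom x) :=
        (continuous_id.matrix_det).comp_continuousOn (continuousOn_twist hc x)
      exact h.isOpen_inter_preimage (E.isOpen_dom x) isOpen_compl_singleton
    mem_dom := fun x => ⟨E.mem_dom x, by simp [twist_self hP x]⟩
    idx := fun x => Fin (Module.finrank ℂ (W x))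
    frame := fun x y k => ⟨P y (ofVec E x y (vec E x x (β x k))), (hP y).map_mem _⟩
    coord := fun x y k =>
      (β x).coord k ∘ₗ (P x).codRestrict (W x) (hP x).map_mem ∘ₗ
        Fintype.linearCombination ℂ (E.frame x x) ∘ₗ (twist E P x y)⁻¹.mulVecLin ∘ₗ
          LinearMap.pi (E.coord x y) ∘ₗ (W y).subtype
    coord_frame := by
      intro x y hy i j
      have h1 : (twist E P x y)⁻¹.mulVec
          (vec E x y (P y (ofVec E x y (vec E x x (β x j))))) = vec E x x (β x j) := by
        rw [vec_apply hy.1, vec_ofVec hy.1]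
        exact inv_twist_mulVec hP hy.2 (by
          rw [← vec_apply (E.mem_dom x), (hP x).map_id _ (β x j).2])
      have h2 : (P x).codRestrict (W x) (hP x).map_mem (ofVec E x x ((twist E P x y)⁻¹.mulVec
          (vec E x y (P y (ofVec E x y (vec E x x (β x j))))))) = β x j := by
        ext
        rw [h1, ofVec_vec (E.mem_dom x)]
        exact (hP x).map_id _ (β x j).2
      refine (congrArg ((β x).coord i) h2).trans ?_
      rw [Module.Basis.coord_apply, Module.Basis.repr_self, Finsupp.single_apply]
      simp only [eq_comm]
    sum_coord_smul_frame := by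
      intro x y hy w
      let z : W x := (P x).codRestrict (W x) (hP x).map_mem
        (ofVec E x x ((twist E P x y)⁻¹.mulVec (vec E x y w)))
      have hz : (twist E P x y).mulVec (vec E x x z) = vec E x y w := by
        have h1 : vec E x x z =
            (mat E P x x).mulVec ((twist E P x y)⁻¹.mulVec (vec E x y w)) := by
          change vec E x x (P x _) = _
          rw [vec_apply (E.mem_dom x), vec_ofVec (E.mem_dom x)]
        rw [h1, Matrix.mulVec_mulVec, ← mat_mul_twist hP hy.1, Matrix.mulVec_mulVec, mul_assoc,
          Matrix.mul_nonsing_inv _ (Ne.isUnit hy.2), mul_one, ← vec_apply hy.1, (hP y).map_id _ w.2]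
      have hz' : P y (ofVec E x y (vec E x x z)) = w := by
        rw [← ofVec_vec hy.1 (P y _), vec_apply hy.1, vec_ofVec hy.1, ← twist_mulVec hP, hz,
          ofVec_vec hy.1]
        rw [← vec_apply (E.mem_dom x), (hP x).map_id _ z.2]
      let T : W x →ₗ[ℂ] E.fiber y :=
        P y ∘ₗ Fintype.linearCombination ℂ (E.frame x y) ∘ₗ LinearMap.pi (E.coord x x) ∘ₗ
          (W x).subtype
      have h2 : ∑ k, (β x).repr z k • T (β x k) = T z := by
        conv_rhs => rw [← (β x).sum_repr z]
        rw [map_sum]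
        simp only [map_smul]
      refine Subtype.ext (Eq.trans ?_ (h2.trans hz'))
      rw [AddSubmonoidClass.coe_finsetSum]
      rfl
    continuousOn_transition := by
      intro x x' i j
      have hW : ContinuousOn (fun y => vec E x y (P y (ofVec E x' y (vec E x' x' (β x' j)))))
          (E.dom x ∩ E.dom x') := by
        refine continuousOn_pi.2 fun k => ?_
        simp only [vec, ofVec, map_sum, map_smul, smul_eq_mul]
        refine continuousOn_finsetSum _ fun l _ => continuousOn_const.mul ?_
        exact (hc x' x k l).mono fun y hy => ⟨hy.2, hy.1⟩
      have hI : ContinuousOn (fun y => (twist E P x y)⁻¹)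
          (E.dom x ∩ (fun y => (twist E P x y).det) ⁻¹' {0}ᶜ) := by
        have ht := (continuousOn_twist hc x).mono
          (Set.inter_subset_left (t := (fun y => (twist E P x y).det) ⁻¹' {0}ᶜ))
        simp only [Matrix.inv_def, Ring.inverse_eq_inv']
        have hd : ContinuousOn (fun y => (twist E P x y).det)
            (E.dom x ∩ (fun y => (twist E P x y).det) ⁻¹' {0}ᶜ) :=
          continuous_id.matrix_det.comp_continuousOn ht
        have ha : ContinuousOn (fun y => (twist E P x y).adjugate)
            (E.dom x ∩ (fun y => (twist E P x y).det) ⁻¹' {0}ᶜ) :=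
          continuous_id.matrix_adjugate.comp_continuousOn ht
        exact (hd.inv₀ fun y hy => hy.2).smul ha
      have hM : ContinuousOn (fun y => (twist E P x y)⁻¹.mulVec
          (vec E x y (P y (ofVec E x' y (vec E x' x' (β x' j))))))
          ((E.dom x ∩ (fun y => (twist E P x y).det) ⁻¹' {0}ᶜ) ∩
            (E.dom x' ∩ (fun y => (twist E P x' y).det) ⁻¹' {0}ᶜ)) := by
        refine continuousOn_pi.2 fun k => ?_
        refine continuousOn_finsetSum _ fun l _ => ContinuousOn.mul ?_ ?_
        · exact (continuousOn_pi.1 (continuousOn_pi.1 hI k) l).mono Set.inter_subset_left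
        · exact (continuousOn_pi.1 hW l).mono fun y hy => ⟨hy.1.1, hy.2.1⟩
      have hL : Continuous ((β x).coord i ∘ₗ (P x).codRestrict (W x) (hP x).map_mem ∘ₗ
          Fintype.linearCombination ℂ (E.frame x x)) :=
        LinearMap.continuous_of_finiteDimensional _
      exact hL.comp_continuousOn hM }

end Summand

end VecBundle

/-! ### Equivariant bundles over a space with trivial action, and the Atiyah–Segal map -/

/-- A `G`-vector bundle over the space `X`, on which `G` acts trivially: a vector bundle with a
fibrewise linear continuous action of `G`. -/
structure GVecBundle (G : Type*) [Group G] (X : Type u) [TopologicalSpace X] extends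
    VecBundle.{u, v} X where
  action : ∀ x, Representation ℂ G (fiber x)
  isContHom_action : ∀ g, VecBundle.IsContHom toVecBundle toVecBundle (fun x => action x g)

namespace GVecBundle

variable {X : Type u} [TopologicalSpace X] {G : Type*} [Group G]

/-- The projection to the eigenspace of `g` for `ξ`: the mean of `ξ⁻ᵏ gᵏ` over `0 ≤ k < ord g` if
`ξ` is a root of unity of order dividing `ord g`, and zero otherwise. -/
def eigenProj (V : GVecBundle.{u, v} G X) (g : G) (ξ : ℂ) (x : X) : V.fiber x →ₗ[ℂ] V.fiber x :=
  open Classical in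
  if ξ ^ orderOf g = 1 then
    (orderOf g : ℂ)⁻¹ • ∑ k ∈ Finset.range (orderOf g), (ξ ^ k)⁻¹ • V.action x (g ^ k)
  else 0

theorem isContHom_eigenProj (V : GVecBundle.{u, v} G X) (g : G) (ξ : ℂ) :
    VecBundle.IsContHom V.toVecBundle V.toVecBundle (V.eigenProj g ξ) := by
  classical
  by_cases h : ξ ^ orderOf g = 1
  · have e : V.eigenProj g ξ = fun x => (orderOf g : ℂ)⁻¹ •
        ∑ k ∈ Finset.range (orderOf g), (ξ ^ k)⁻¹ • V.action x (g ^ k) := by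
      funext x
      simp only [eigenProj, if_pos h]
    rw [e]
    apply VecBundle.IsContHom.smul
    generalize orderOf g = n
    induction n with
    | zero => simpa using VecBundle.isContHom_zero _ _
    | succ n ih =>
      simp only [Finset.sum_range_succ]
      exact ih.add ((V.isContHom_action (g ^ n)).smul _)
  · have e : V.eigenProj g ξ = fun x => 0 := by
      funext x
      simp only [eigenProj, if_neg h]
    rw [e]
    exact VecBundle.isContHom_zero _ _

theorem isProj_eigenProj [Finite G] (V : GVecBundle.{u, v} G X) (g : G) (ξ : ℂ) (x : X) :
    LinearMap.IsProj (Module.End.eigenspace (V.action x g) ξ) (V.eigenProj g ξ x) := by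
  classical
  have hN : 0 < orderOf g := orderOf_pos g
  have hpow : ∀ w ∈ Module.End.eigenspace (V.action x g) ξ, ∀ k : ℕ,
      V.action x (g ^ k) w = ξ ^ k • w := by
    intro w hw k
    rw [Module.End.mem_eigenspace_iff] at hw
    induction k with
    | zero => simp
    | succ k ih => rw [pow_succ, map_mul, Module.End.mul_apply, hw, map_smul, ih, smul_smul,
        pow_succ, mul_comm]
  by_cases h : ξ ^ orderOf g = 1
  · have hξ : ξ ≠ 0 := by
      rintro rfl
      rw [zero_pow hN.ne'] at h
      exact zero_ne_one h
    constructor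
    · intro w
      rw [Module.End.mem_eigenspace_iff]
      simp only [eigenProj, if_pos h, LinearMap.smul_apply, LinearMap.sum_apply, map_smul, map_sum]
      rw [smul_comm ξ]
      congr 1
      have hs := Finset.sum_range_succ' (fun k => (ξ ^ k)⁻¹ • V.action x (g ^ k) w) (orderOf g)
      rw [Finset.sum_range_succ, pow_orderOf_eq_one, h] at hs
      simp only [pow_zero] at hs
      rw [add_right_cancel hs, Finset.smul_sum]
      refine Finset.sum_congr rfl fun k _ => ?_
      rw [← Module.End.mul_apply, ← map_mul, ← pow_succ', smul_smul]
      congr 1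
      rw [pow_succ]
      field_simp
    · intro w hw
      have hN' : (orderOf g : ℂ) ≠ 0 := by exact_mod_cast hN.ne'
      simp only [eigenProj, if_pos h, LinearMap.smul_apply, LinearMap.sum_apply, hpow w hw,
        smul_smul]
      rw [Finset.sum_congr rfl (g := fun _ => w) fun k _ => by
        rw [inv_mul_cancel₀ (pow_ne_zero k hξ), one_smul]]
      rw [Finset.sum_const, Finset.card_range, ← Nat.cast_smul_eq_nsmul ℂ, smul_smul,
        inv_mul_cancel₀ hN', one_smul]
  · constructor
    · intro w
      simp only [eigenProj, if_neg h, LinearMap.zero_apply]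
      exact Submodule.zero_mem _
    · intro w hw
      have h1 := hpow w hw (orderOf g)
      rw [pow_orderOf_eq_one, map_one, Module.End.one_apply] at h1
      have h2 : (1 - ξ ^ orderOf g) • w = 0 := by
        rw [sub_smul, one_smul, ← h1, sub_self]
      rcases smul_eq_zero.1 h2 with h3 | h3
      · exact absurd (sub_eq_zero.1 h3).symm h
      · simp [h3]

/-- The subbundle `V_ξ` of `V` whose fibres are the eigenspaces of `g` for `ξ`. -/
def eigenbundle [Finite G] (V : GVecBundle.{u, v} G X) (g : G) (ξ : ℂ) : VecBundle.{u, v} X :=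
  VecBundle.Summand.ofProj (fun x => Module.End.eigenspace (V.action x g) ξ)
    (V.isContHom_eigenProj g ξ) (V.isProj_eigenProj g ξ)

end GVecBundle

/-! ### The semiring of isomorphism classes of vector bundles -/

namespace VecBundle

variable {X : Type u} [TopologicalSpace X]

theorem isIso_directSum_congr {E E' F F' : VecBundle.{u, v} X} :
    IsIso E E' → IsIso F F' → IsIso (directSum E F) (directSum E' F') := by
  have key : ∀ {E E' F F' : VecBundle.{u, v} X} {f : ∀ x, E.fiber x →ₗ[ℂ] E'.fiber x}
      {g : ∀ x, F.fiber x →ₗ[ℂ] F'.fiber x}, IsContHom E E' f → IsContHom F F' g →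
      IsContHom (directSum E F) (directSum E' F') (fun x => (f x).prodMap (g x)) := by
    intro E E' F F' f g hf hg x x' i j
    rcases i with i | i <;> rcases j with j | j
    · exact ContinuousOn.mono (hf x x' i j) fun y hy => ⟨hy.1.1, hy.2.1⟩
    · refine (continuousOn_const (c := (0 : ℂ))).congr fun y _ => ?_
      change E'.coord x' y i (f y 0) = 0
      simp
    · refine (continuousOn_const (c := (0 : ℂ))).congr fun y _ => ?_
      change F'.coord x' y i (g y 0) = 0
      simp
    · exact ContinuousOn.mono (hg x x' i j) fun y hy => ⟨hy.1.2, hy.2.2⟩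
  rintro ⟨f, hf, hf'⟩ ⟨g, hg, hg'⟩
  exact ⟨fun x => (f x).prodCongr (g x), key hf hg, key hf' hg'⟩

theorem isIso_tensor_congr {E E' F F' : VecBundle.{u, v} X} :
    IsIso E E' → IsIso F F' → IsIso (tensor E F) (tensor E' F') := by
  have key : ∀ {E E' F F' : VecBundle.{u, v} X} {f : ∀ x, E.fiber x →ₗ[ℂ] E'.fiber x}
      {g : ∀ x, F.fiber x →ₗ[ℂ] F'.fiber x}, IsContHom E E' f → IsContHom F F' g →
      IsContHom (tensor E F) (tensor E' F') (fun x => TensorProduct.map (f x) (g x)) := by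
    intro E E' F F' f g hf hg x x' i j
    have h1 : ContinuousOn (fun y => E'.coord x' y i.1 (f y (E.frame x y j.1)))
        ((E.dom x ∩ F.dom x) ∩ (E'.dom x' ∩ F'.dom x')) :=
      ContinuousOn.mono (hf x x' i.1 j.1) fun y hy => ⟨hy.1.1, hy.2.1⟩
    have h2 : ContinuousOn (fun y => F'.coord x' y i.2 (g y (F.frame x y j.2)))
        ((E.dom x ∩ F.dom x) ∩ (E'.dom x' ∩ F'.dom x')) :=
      ContinuousOn.mono (hg x x' i.2 j.2) fun y hy => ⟨hy.1.2, hy.2.2⟩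
    refine (h1.mul h2).congr fun y _ => ?_
    rfl
  rintro ⟨f, hf, hf'⟩ ⟨g, hg, hg'⟩
  exact ⟨fun x => TensorProduct.congr (f x) (g x), key hf hg, key hf' hg'⟩

theorem isIso_directSum_assoc (E F G : VecBundle.{u, v} X) :
    IsIso (directSum (directSum E F) G) (directSum E (directSum F G)) := by
  refine isIso_of_frame (fun _ => LinearEquiv.prodAssoc ℂ _ _ _) (fun _ => Equiv.sumAssoc _ _ _)
    (fun _ => Set.inter_assoc _ _ _) ?_
  rintro x y - ((j | j) | j) <;> rfl

theorem isIso_directSum_comm (E F : VecBundle.{u, v} X) :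
    IsIso (directSum E F) (directSum F E) := by
  refine isIso_of_frame (fun _ => LinearEquiv.prodComm ℂ _ _) (fun _ => Equiv.sumComm _ _)
    (fun _ => Set.inter_comm _ _) ?_
  rintro x y - (j | j) <;> rfl

theorem isIso_zero_directSum (E : VecBundle.{u, v} X) : IsIso (directSum (zero X) E) E := by
  refine isIso_of_frame (fun _ => LinearEquiv.uniqueProd (M₂ := PUnit.{v + 1}))
    (fun _ => Equiv.emptySum Empty _) (fun _ => Set.univ_inter _) ?_
  rintro x y - (j | j)
  · exact j.elim
  · rfl

theorem isIso_tensor_assoc (E F G : VecBundle.{u, v} X) :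
    IsIso (tensor (tensor E F) G) (tensor E (tensor F G)) := by
  refine isIso_of_frame
    (fun x => TensorProduct.assoc ℂ (E.fiber x) (F.fiber x) (G.fiber x)) (fun _ => Equiv.prodAssoc _ _ _)
    (fun _ => Set.inter_assoc _ _ _) ?_
  rintro x y - ⟨⟨i, j⟩, k⟩
  rfl

theorem isIso_tensor_comm (E F : VecBundle.{u, v} X) : IsIso (tensor E F) (tensor F E) := by
  refine isIso_of_frame (fun x => TensorProduct.comm ℂ (E.fiber x) (F.fiber x)) (fun _ => Equiv.prodComm _ _)
    (fun _ => Set.inter_comm _ _) ?_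
  rintro x y - ⟨i, j⟩
  rfl

theorem isIso_one_tensor (E : VecBundle.{u, v} X) : IsIso (tensor (one X) E) E := by
  refine isIso_of_frame
    (fun x => (TensorProduct.congr (ULift.moduleEquiv : ULift.{v} ℂ ≃ₗ[ℂ] ℂ)
      (LinearEquiv.refl ℂ (E.fiber x))).trans (TensorProduct.lid ℂ (E.fiber x)))
    (fun _ => Equiv.punitProd _) (fun _ => Set.univ_inter _) ?_
  rintro x y - ⟨⟨⟩, j⟩
  change (1 : ℂ) • E.frame x y j = E.frame x y j
  rw [one_smul]

theorem isIso_zero_tensor (E : VecBundle.{u, v} X) : IsIso (tensor (zero X) E) (zero X) := by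
  have : ∀ x, Subsingleton ((tensor (zero X) E).fiber x) := fun x =>
    inferInstanceAs (Subsingleton (PUnit.{v + 1} ⊗[ℂ] E.fiber x))
  have : ∀ x, Subsingleton ((zero X).fiber x) := fun x =>
    inferInstanceAs (Subsingleton PUnit.{v + 1})
  refine ⟨fun x => { (0 : (tensor (zero X) E).fiber x →ₗ[ℂ] (zero X).fiber x) with
    invFun := 0
    left_inv := fun _ => Subsingleton.elim _ _
    right_inv := fun _ => Subsingleton.elim _ _ }, ?_, ?_⟩
  · exact fun x x' i j => i.elim
  · exact fun x x' i j => j.elim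

theorem isIso_tensor_directSum (E F G : VecBundle.{u, v} X) :
    IsIso (tensor E (directSum F G)) (directSum (tensor E F) (tensor E G)) := by
  refine isIso_of_frame (fun _ => TensorProduct.prodRight ℂ ℂ _ _ _)
    (fun _ => Equiv.prodSumDistrib _ _ _) (fun _ => Set.inter_inter_distrib_left _ _ _) ?_
  rintro x y - ⟨i, j | j⟩
  · refine (TensorProduct.prodRight_tmul ℂ ℂ _ _ _ _ _).trans ?_
    exact Prod.ext rfl (TensorProduct.tmul_zero _ _)
  · refine (TensorProduct.prodRight_tmul ℂ ℂ _ _ _ _ _).trans ?_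
    exact Prod.ext (TensorProduct.tmul_zero _ _) rfl

/-- The relation of being isomorphic. -/
instance isoSetoid (X : Type u) [TopologicalSpace X] : Setoid (VecBundle.{u, v} X) where
  r := IsIso
  iseqv := ⟨IsIso.refl, IsIso.symm, IsIso.trans⟩

end VecBundle

/-- The isomorphism classes of complex vector bundles on `X`. -/
def VectClass (X : Type u) [TopologicalSpace X] : Type (max u (v + 1)) :=
  Quotient (VecBundle.isoSetoid.{u, v} X)

namespace VectClass

variable {X : Type u} [TopologicalSpace X]

/-- The isomorphism class of a vector bundle. -/
def mk (E : VecBundle.{u, v} X) : VectClass.{u, v} X := Quotient.mk _ E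

instance : Add (VectClass.{u, v} X) where
  add := Quotient.map₂ VecBundle.directSum fun _ _ h _ _ h' => VecBundle.isIso_directSum_congr h h'

instance : Mul (VectClass.{u, v} X) where
  mul := Quotient.map₂ VecBundle.tensor fun _ _ h _ _ h' => VecBundle.isIso_tensor_congr h h'

instance : Zero (VectClass.{u, v} X) where
  zero := mk (VecBundle.zero X)

instance : One (VectClass.{u, v} X) where
  one := mk (VecBundle.one X)

/-- Isomorphism classes of vector bundles form a commutative semiring under direct sum and tensor
product. -/
instance : CommSemiring (VectClass.{u, v} X) where
  add_assoc := by
    rintro ⟨E⟩ ⟨F⟩ ⟨G⟩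
    exact Quotient.sound (VecBundle.isIso_directSum_assoc E F G)
  add_comm := by
    rintro ⟨E⟩ ⟨F⟩
    exact Quotient.sound (VecBundle.isIso_directSum_comm E F)
  zero_add := by
    rintro ⟨E⟩
    exact Quotient.sound (VecBundle.isIso_zero_directSum E)
  add_zero := by
    rintro ⟨E⟩
    exact Quotient.sound
      ((VecBundle.isIso_directSum_comm _ _).trans (VecBundle.isIso_zero_directSum E))
  mul_assoc := by
    rintro ⟨E⟩ ⟨F⟩ ⟨G⟩
    exact Quotient.sound (VecBundle.isIso_tensor_assoc E F G)
  mul_comm := by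
    rintro ⟨E⟩ ⟨F⟩
    exact Quotient.sound (VecBundle.isIso_tensor_comm E F)
  one_mul := by
    rintro ⟨E⟩
    exact Quotient.sound (VecBundle.isIso_one_tensor E)
  mul_one := by
    rintro ⟨E⟩
    exact Quotient.sound ((VecBundle.isIso_tensor_comm _ _).trans (VecBundle.isIso_one_tensor E))
  zero_mul := by
    rintro ⟨E⟩
    exact Quotient.sound (VecBundle.isIso_zero_tensor E)
  mul_zero := by
    rintro ⟨E⟩
    exact Quotient.sound ((VecBundle.isIso_tensor_comm _ _).trans (VecBundle.isIso_zero_tensor E))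
  left_distrib := by
    rintro ⟨E⟩ ⟨F⟩ ⟨G⟩
    exact Quotient.sound (VecBundle.isIso_tensor_directSum E F G)
  right_distrib := by
    rintro ⟨E⟩ ⟨F⟩ ⟨G⟩
    exact Quotient.sound ((VecBundle.isIso_tensor_comm _ _).trans
      ((VecBundle.isIso_tensor_directSum G E F).trans
        (VecBundle.isIso_directSum_congr (VecBundle.isIso_tensor_comm _ _)
          (VecBundle.isIso_tensor_comm _ _))))
  nsmul := nsmulRec
  npow := npowRec

end VectClass

/-! ### The Grothendieck ring of a commutative semiring -/

namespace GrothendieckRing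

open Algebra

variable {S : Type*} [CommSemiring S]

theorem lift_of {A : Type*} [AddCommGroup A] (f : S →+ A) (s : S) :
    GrothendieckAddGroup.lift f (GrothendieckAddGroup.of s) = f s :=
  DFunLike.congr_fun (GrothendieckAddGroup.lift.symm_apply_apply f) s

theorem hom_ext {A : Type*} [AddCommGroup A] {f g : GrothendieckAddGroup S →+ A}
    (h : ∀ s, f (GrothendieckAddGroup.of s) = g (GrothendieckAddGroup.of s)) : f = g :=
  GrothendieckAddGroup.lift.symm.injective (AddMonoidHom.ext h)

/-- The biadditive extension of the multiplication of a semiring to its Grothendieck group. -/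
def mulHom : GrothendieckAddGroup S →+ GrothendieckAddGroup S →+ GrothendieckAddGroup S :=
  GrothendieckAddGroup.lift
    { toFun := fun s => GrothendieckAddGroup.lift
        ((GrothendieckAddGroup.of (M := S)).comp (AddMonoidHom.mulLeft s))
      map_zero' := hom_ext fun t => by
        rw [lift_of, AddMonoidHom.comp_apply, AddMonoidHom.coe_mulLeft, zero_mul, map_zero,
          AddMonoidHom.zero_apply]
      map_add' := fun a b => hom_ext fun t => by
        rw [AddMonoidHom.add_apply, lift_of, lift_of, lift_of]
        simp only [AddMonoidHom.comp_apply, AddMonoidHom.coe_mulLeft, add_mul, map_add] }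

theorem mulHom_of (a b : S) :
    mulHom (GrothendieckAddGroup.of a) (GrothendieckAddGroup.of b) =
      GrothendieckAddGroup.of (a * b) := by
  simp only [mulHom]
  rw [lift_of]
  exact lift_of _ _

theorem exists_eq_sub (z : GrothendieckAddGroup S) :
    ∃ a b : S, z = GrothendieckAddGroup.of a - GrothendieckAddGroup.of b := by
  induction z using AddLocalization.ind with
  | _ y =>
    refine ⟨y.1, y.2, ?_⟩
    rw [eq_sub_iff_add_eq]
    have h := (AddLocalization.addMonoidOf (⊤ : AddSubmonoid S)).mk'_spec y.1 y.2
    rw [← AddLocalization.mk_eq_addMonoidOf_mk'] at h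
    exact h

/-- The Grothendieck group of a commutative semiring is a commutative ring. -/
instance : CommRing (GrothendieckAddGroup S) where
  __ : AddCommGroup (GrothendieckAddGroup S) := inferInstance
  mul a b := mulHom a b
  one := GrothendieckAddGroup.of 1
  left_distrib a b c := map_add (mulHom a) b c
  right_distrib a b c := by
    change mulHom (a + b) c = mulHom a c + mulHom b c
    simp
  zero_mul a := by
    change mulHom 0 a = 0
    simp
  mul_zero a := by
    change mulHom a 0 = 0
    simp
  mul_assoc x y z := by
    change mulHom (mulHom x y) z = mulHom x (mulHom y z)
    obtain ⟨a, a', rfl⟩ := exists_eq_sub x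
    obtain ⟨b, b', rfl⟩ := exists_eq_sub y
    obtain ⟨c, c', rfl⟩ := exists_eq_sub z
    simp only [map_sub, AddMonoidHom.sub_apply, mulHom_of, mul_assoc]
  mul_comm x y := by
    change mulHom x y = mulHom y x
    obtain ⟨a, a', rfl⟩ := exists_eq_sub x
    obtain ⟨b, b', rfl⟩ := exists_eq_sub y
    simp only [map_sub, AddMonoidHom.sub_apply, mulHom_of, mul_comm b, mul_comm b']
    abel
  one_mul x := by
    change mulHom (GrothendieckAddGroup.of 1) x = x
    obtain ⟨a, a', rfl⟩ := exists_eq_sub x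
    simp only [map_sub, mulHom_of, one_mul]
  mul_one x := by
    change mulHom x (GrothendieckAddGroup.of 1) = x
    obtain ⟨a, a', rfl⟩ := exists_eq_sub x
    simp only [map_sub, AddMonoidHom.sub_apply, mulHom_of, mul_one]

end GrothendieckRing

/-- The K-group `K(X) = K⁰(X)`: the Grothendieck group of the isomorphism classes of complex vector
bundles on `X` under direct sum; it is a ring under tensor product. -/
abbrev KTheory (X : Type u) [TopologicalSpace X] : Type (max u (v + 1)) :=
  Algebra.GrothendieckAddGroup (VectClass.{u, v} X)

/-- The class `[E] ∈ K(X)` of a vector bundle `E`. -/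
def VecBundle.kclass {X : Type u} [TopologicalSpace X] (E : VecBundle.{u, v} X) :
    KTheory.{u, v} X :=
  Algebra.GrothendieckAddGroup.of (VectClass.mk E)

/-! ### The Atiyah–Segal map and the Adams operations -/

/-- The `g`-component `φ_g` of the Atiyah–Segal map, on a `G`-vector bundle `V` over a space `X` on
which `G` acts trivially (so that all of `X` is fixed by `g`): `φ_g(V) = ∑_ξ ξ [V_ξ]` in
`ℂ ⊗ K(X)`.  The eigenvalues `ξ` of `g` all satisfy `ξ ^ ord g = 1`; if such a `ξ` is not an
eigenvalue then `V_ξ = 0`. -/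
def GVecBundle.atiyahSegal {X : Type u} [TopologicalSpace X] {G : Type*} [Group G] [Finite G]
    (V : GVecBundle.{u, v} G X) (g : G) : ℂ ⊗[ℤ] KTheory.{u, v} X :=
  ∑ ξ ∈ Polynomial.nthRootsFinset (orderOf g) (1 : ℂ), ξ ⊗ₜ[ℤ] (V.eigenbundle g ξ).kclass

/-- The tensor power `E^{⊗ n}` as an `S_n`-vector bundle:
`σ (v_1 ⊗ ⋯ ⊗ v_n) = v_{σ⁻¹(1)} ⊗ ⋯ ⊗ v_{σ⁻¹(n)}`. -/
def VecBundle.symTensorPower {X : Type u} [TopologicalSpace X] (E : VecBundle.{u, v} X) (n : ℕ) :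
    GVecBundle.{u, v} (Equiv.Perm (Fin n)) X where
  toVecBundle := E.tensorPower n
  action x :=
    { toFun := fun σ => (PiTensorProduct.reindex ℂ (fun _ : Fin n => E.fiber x) σ).toLinearMap
      map_one' := by
        apply PiTensorProduct.ext
        ext w
        exact PiTensorProduct.reindex_tprod _ _
      map_mul' := fun σ τ => by
        apply PiTensorProduct.ext
        ext w
        change PiTensorProduct.reindex ℂ (fun _ : Fin n => E.fiber x) (σ * τ)
            (PiTensorProduct.tprod ℂ w) =
          PiTensorProduct.reindex ℂ (fun _ : Fin n => E.fiber x) σ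
            (PiTensorProduct.reindex ℂ (fun _ : Fin n => E.fiber x) τ
              (PiTensorProduct.tprod ℂ w))
        rw [PiTensorProduct.reindex_tprod, PiTensorProduct.reindex_tprod,
          PiTensorProduct.reindex_tprod]
        rfl }
  isContHom_action σ :=
    VecBundle.isContHom_of_frame _ (fun _ i => i ∘ σ.symm) (fun _ => subset_rfl)
      fun _ _ _ _ => PiTensorProduct.reindex_tprod _ _

/-- Newton's polynomials: `newtonPoly e n` is the expression of the power sum `∑ xᵢⁿ` in terms of the
elementary symmetric functions `e k` of the `xᵢ`, given for `n ≥ 1` by Newton's recursion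
`pₙ = e₁ pₙ₋₁ - e₂ pₙ₋₂ + ⋯ + (-1)ⁿ⁻² eₙ₋₁ p₁ + (-1)ⁿ⁻¹ n eₙ`. -/
def newtonPoly {R : Type*} [CommRing R] (e : ℕ → R) : ℕ → R
  | 0 => 0
  | n + 1 => ∑ i : Fin n, (-1) ^ (i : ℕ) * e (i + 1) * newtonPoly e (n - i) +
      (-1) ^ n * (n + 1) * e (n + 1)

/-- The `n`-th Adams operation on (the class of) a vector bundle, `n ≥ 1`: the `n`-th Newton
polynomial in the exterior powers of the bundle. -/
def VecBundle.adams {X : Type u} [TopologicalSpace X] (n : ℕ) (E : VecBundle.{u, v} X) :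
    KTheory.{u, v} X :=
  newtonPoly (fun k => (E.extPower k).kclass) n

/-- A line bundle is a vector bundle all of whose fibres are one-dimensional. -/
def VecBundle.IsLineBundle {X : Type u} [TopologicalSpace X] (L : VecBundle.{u, v} X) : Prop :=
  ∀ x, Module.finrank ℂ (L.fiber x) = 1

end

/-! The components of the Atiyah–Segal map are the values of a trace on the group algebra. Let a
finite group `G` act on a bundle `V` over `X`. An idempotent `e` of `ℂ[G]` has an image subbundle in
`V`; its class is additive on orthogonal idempotents and equal for `ab` and `ba`. Since `ℂ[G]` is a
product of matrix algebras, such a rank function extends to a linear map `τ` with values in `ℂ ⊗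
K(X)`, with `τ(ab) = τ(ba)` and `τ(e) = 1 ⊗ [eV]` (`IsRankFunction.exists_trace`). As `g = ∑ ξ e_ξ`,
where `e_ξ` projects to the `ξ`-eigenbundle, `φ_g(V) = τ(g)` (`GVecBundle.atiyahSegal_eq_trace`).

This makes available the computation with characters of symmetric groups, with no splitting
principle. On tensor powers of `E` the trace is multiplicative along `S_i × S_j ⊆ S_{i+j}`
(`VecBundle.trace_symTensorPower_mul`), and the antisymmetrizer has trace `[Λ^k E]`
(`VecBundle.trace_antisymmetrizer`). Number the points `0, …, N`; let `A_m` be the signed sum of the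
permutations of the first `m` points, and `c_i` the cycle on `i, …, N`. Splitting `A_{i+2}` into
cosets of the permutations of the first `i+1` points gives `A_{i+1}` times a sum of transpositions.
In `A_{i+2} c_{i+1}` the trivial coset contributes `A_{i+1} c_{i+1}`, whose trace is `(i+1)!
[Λ^{i+1} E] φ_{N-i}`, with `φ_k` the value at the `k`-cycle on `E^{⊗k}`; each of the other `i+1`
cosets contributes a conjugate of `-A_{i+1} c_i`. Unrolled up to `i = N`, this is Newton's identity
between the `[Λ^k E]` and the `φ_k` (`VecBundle.newton_atiyahSegal`). It is the recursion that
defines `newtonPoly`, so `φ_n = 1 ⊗ ψ^n(E)` by induction.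

For a sum of line bundles, `Λ^{k+1}(F ⊕ L) ≅ Λ^{k+1} F ⊕ (Λ^k F ⊗ L)` shows that `[Λ^k E]` is the
`k`-th elementary symmetric function of the `[L_m]`. Newton's identities for polynomials then give
`∑ [L_m]^n` already in `K(X)`. -/

noncomputable section

/-! ### Traces on semisimple algebras -/

/-- A function on the idempotents of a ring that is additive on orthogonal idempotents and takes
the same value on equivalent idempotents. -/
structure IsRankFunction {A K : Type*} [Ring A] [AddCommGroup K] (κ : A → K) : Prop where
  add : ∀ e f : A, IsIdempotentElem e → IsIdempotentElem f → e * f = 0 → f * e = 0 →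
    κ (e + f) = κ e + κ f
  comm : ∀ a b : A, IsIdempotentElem (a * b) → IsIdempotentElem (b * a) → κ (a * b) = κ (b * a)

namespace IsRankFunction

variable {A B K : Type*} [Ring A] [Ring B] [AddCommGroup K] {κ : A → K}

theorem zero (h : IsRankFunction κ) : κ 0 = 0 := by
  have h0 := h.add 0 0 IsIdempotentElem.zero IsIdempotentElem.zero (zero_mul 0) (zero_mul 0)
  simpa using h0

theorem comp (h : IsRankFunction κ) (φ : B →ₙ+* A) : IsRankFunction (fun b => κ (φ b)) where
  add e f he hf hef hfe := by
    rw [map_add]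
    exact h.add _ _ (he.map φ) (hf.map φ) (by rw [← map_mul, hef, map_zero])
      (by rw [← map_mul, hfe, map_zero])
  comm a b hab hba := by
    have h1 := hab.map φ
    have h2 := hba.map φ
    rw [map_mul] at h1 h2 ⊢
    rw [map_mul]
    exact h.comm _ _ h1 h2

/-- Induction on the trace: a nonzero idempotent splits off a rank-one idempotent equivalent to the
matrix unit at `(0, 0)`. In characteristic zero an idempotent of trace zero vanishes, which starts
the induction. -/
theorem matrix {F : Type*} [Field F] [CharZero F] {d : ℕ} [NeZero d]
    {κ : Matrix (Fin d) (Fin d) F → K} (h : IsRankFunction κ) (r : ℕ)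
    (m : Matrix (Fin d) (Fin d) F) (hm : IsIdempotentElem m) (hr : m.trace = r) :
    κ m = r • κ (Matrix.single 0 0 1) := by
  induction r generalizing m with
  | zero =>
    have h0 : m = 0 := by
      have h1 : IsIdempotentElem (Matrix.toLin' m) := by
        rw [IsIdempotentElem, Module.End.mul_eq_comp, ← Matrix.toLin'_mul, hm.eq]
      have h2 := (LinearMap.IsIdempotentElem.trace_eq_zero_iff h1).1
        (by rw [Matrix.trace_toLin'_eq, hr, Nat.cast_zero])
      simpa using h2
    rw [h0, h.zero, zero_smul]
  | succ r ih =>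
    have h0 : m ≠ 0 := by
      rintro rfl
      rw [Matrix.trace_zero] at hr
      exact (Nat.cast_ne_zero (R := F)).2 (Nat.succ_ne_zero r) hr.symm
    obtain ⟨i, j, hij⟩ : ∃ i j, m i j ≠ 0 := by
      by_contra! hc
      exact h0 (Matrix.ext hc)
    -- The factor `(m i j)⁻¹` makes `b * a` the matrix unit at `(0, 0)`. Hence `a * b` is an
    -- idempotent equivalent to it, and it lies under `m`: multiplication by `m` on either side
    -- fixes it.
    set a : Matrix (Fin d) (Fin d) F := m * Matrix.single j 0 1 with ha
    set b : Matrix (Fin d) (Fin d) F := Matrix.single 0 i (m i j)⁻¹ * m with hb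
    have hba : b * a = Matrix.single 0 0 1 := by
      have h1 : b * a = Matrix.single 0 i (m i j)⁻¹ * (m * m) * Matrix.single j 0 1 := by
        simp only [ha, hb, mul_assoc]
      rw [h1, hm.eq, Matrix.single_mul_mul_single, inv_mul_cancel₀ hij, one_mul]
    have hE : IsIdempotentElem (Matrix.single 0 0 1 : Matrix (Fin d) (Fin d) F) := by
      simp [IsIdempotentElem]
    have haE : a * Matrix.single 0 0 1 = a := by
      rw [ha, mul_assoc, Matrix.single_mul_single_same, one_mul]
    have hab : IsIdempotentElem (a * b) := by
      rw [IsIdempotentElem, mul_assoc, ← mul_assoc b, hba, ← mul_assoc, haE]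
    have hma : m * a = a := by rw [ha, ← mul_assoc, hm.eq]
    have hbm : b * m = b := by rw [hb, mul_assoc, hm.eq]
    have h1 : m * (a * b) = a * b := by rw [← mul_assoc, hma]
    have h2 : a * b * m = a * b := by rw [mul_assoc, hbm]
    have hd : IsIdempotentElem (m - a * b) := by
      rw [IsIdempotentElem, sub_mul, mul_sub, mul_sub, h1, h2, hm.eq, hab.eq]
      abel
    have h3 := h.add (m - a * b) (a * b) hd hab (by rw [sub_mul, h1, hab.eq, sub_self])
      (by rw [mul_sub, h2, hab.eq, sub_self])
    have ht : (m - a * b).trace = r := by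
      rw [Matrix.trace_sub, hr, Matrix.trace_mul_comm a b, hba, Matrix.trace_single_eq_same]
      simp
    rw [sub_add_cancel, ih _ hd ht, h.comm a b hab (hba ▸ hE), hba] at h3
    rw [h3, succ_nsmul]

theorem sum_single {n : ℕ} {R : Fin n → Type*} [∀ i, Ring (R i)] {κ : (∀ i, R i) → K}
    (h : IsRankFunction κ) (b : ∀ i, R i) (hb : IsIdempotentElem b) :
    κ b = ∑ i, κ (Pi.single i (b i)) := by
  have hs : ∀ i, IsIdempotentElem (Pi.single i (b i) : ∀ i, R i) := by
    intro i
    rw [IsIdempotentElem, ← Pi.single_mul, ← Pi.mul_apply, hb.eq]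
  have ho : ∀ i j, i ≠ j → (Pi.single i (b i) * Pi.single j (b j) : ∀ i, R i) = 0 := by
    intro i j hij
    funext k
    rcases eq_or_ne k i with rfl | hk
    · simp [Pi.single_eq_of_ne hij]
    · simp [Pi.single_eq_of_ne hk]
  have key : ∀ s : Finset (Fin n), IsIdempotentElem (∑ i ∈ s, Pi.single i (b i)) ∧
      κ (∑ i ∈ s, Pi.single i (b i)) = ∑ i ∈ s, κ (Pi.single i (b i)) := by
    intro s
    induction s using Finset.induction_on with
    | empty => simp [h.zero, IsIdempotentElem.zero]
    | insert i s hi ih =>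
      have h1 : Pi.single i (b i) * ∑ j ∈ s, Pi.single j (b j) = 0 := by
        rw [Finset.mul_sum]
        exact Finset.sum_eq_zero fun j hj => ho i j fun h => hi (h ▸ hj)
      have h2 : (∑ j ∈ s, Pi.single j (b j)) * Pi.single i (b i) = 0 := by
        rw [Finset.sum_mul]
        exact Finset.sum_eq_zero fun j hj => ho j i fun h => hi (h ▸ hj)
      rw [Finset.sum_insert hi, Finset.sum_insert hi, h.add _ _ (hs i) ih.1 h1 h2, ih.2]
      refine ⟨?_, rfl⟩
      rw [IsIdempotentElem, add_mul, mul_add, mul_add, h1, h2, (hs i).eq, ih.1.eq]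
      abel
  conv_lhs => rw [← Finset.univ_sum_single b]
  exact (key Finset.univ).2

/-- The trace is `∑ i, tr(a i) ⊗ κ(E_i)`, with `E_i` the matrix unit at `(0, 0)` in the block `i`.
On idempotents `tr` is the rank, and `κ` counts copies of `E_i` by the matrix case. -/
theorem exists_trace_pi_matrix {n : ℕ} {d : Fin n → ℕ} [∀ i, NeZero (d i)]
    {κ : (∀ i, Matrix (Fin (d i)) (Fin (d i)) ℂ) → K} (h : IsRankFunction κ) :
    ∃ τ : (∀ i, Matrix (Fin (d i)) (Fin (d i)) ℂ) →ₗ[ℂ] ℂ ⊗[ℤ] K,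
      (∀ e, IsIdempotentElem e → τ e = 1 ⊗ₜ κ e) ∧ ∀ a b, τ (a * b) = τ (b * a) := by
  refine ⟨∑ i, ((Matrix.traceLinearMap (Fin (d i)) ℂ ℂ).smulRight
    (1 ⊗ₜ κ (Pi.single i (Matrix.single 0 0 1)))) ∘ₗ LinearMap.proj i, ?_, ?_⟩
  · intro e he
    have hi : ∀ i, IsIdempotentElem (e i) := fun i => congrFun he.eq i
    rw [h.sum_single e he, TensorProduct.tmul_sum, LinearMap.sum_apply]
    refine Finset.sum_congr rfl fun i _ => ?_
    have hr : (e i).trace = (Module.finrank ℂ (LinearMap.range (Matrix.toLin' (e i))) : ℕ) := by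
      have h1 : IsIdempotentElem (Matrix.toLin' (e i)) := by
        rw [IsIdempotentElem, Module.End.mul_eq_comp, ← Matrix.toLin'_mul, (hi i).eq]
      rw [← Matrix.trace_toLin'_eq]
      exact LinearMap.IsProj.trace
        (LinearMap.isProj_range_iff_isIdempotentElem _ |>.2 h1)
    -- The inclusion of a block does not preserve the unit, which is why rank functions are pulled
    -- back along non-unital homomorphisms.
    have h2 := (h.comp { toFun := fun m => Pi.single i m
                         map_mul' := fun a b => funext fun j => by
                           rcases eq_or_ne j i with rfl | hj
                           · simp
                           · simp [Pi.single_eq_of_ne hj]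
                         map_zero' := Pi.single_zero i
                         map_add' := fun a b => funext fun j => by
                           rcases eq_or_ne j i with rfl | hj
                           · simp
                           · simp [Pi.single_eq_of_ne hj] }).matrix _ (e i) (hi i) hr
    change κ (Pi.single i (e i)) = _ • κ (Pi.single i (Matrix.single 0 0 1)) at h2
    rw [h2]
    simp only [LinearMap.comp_apply, LinearMap.proj_apply, LinearMap.smulRight_apply,
      Matrix.traceLinearMap_apply]
    rw [hr, TensorProduct.tmul_smul, Nat.cast_smul_eq_nsmul]
  · intro a b
    simp only [LinearMap.sum_apply, LinearMap.comp_apply, LinearMap.proj_apply,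
      LinearMap.smulRight_apply, Matrix.traceLinearMap_apply, Pi.mul_apply]
    refine Finset.sum_congr rfl fun i _ => ?_
    rw [Matrix.trace_mul_comm]

/-- By Wedderburn–Artin over the algebraically closed field `ℂ`, the algebra is a product of matrix
algebras over `ℂ`. -/
theorem exists_trace [Algebra ℂ A] [IsSemisimpleRing A] [FiniteDimensional ℂ A]
    (h : IsRankFunction κ) :
    ∃ τ : A →ₗ[ℂ] ℂ ⊗[ℤ] K,
      (∀ e, IsIdempotentElem e → τ e = 1 ⊗ₜ κ e) ∧ ∀ a b, τ (a * b) = τ (b * a) := by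
  obtain ⟨n, d, hd, ⟨φ⟩⟩ := IsSemisimpleRing.exists_algEquiv_pi_matrix_of_isAlgClosed ℂ A
  obtain ⟨τ, h1, h2⟩ := (h.comp (NonUnitalRingHomClass.toNonUnitalRingHom φ.symm)).exists_trace_pi_matrix
  refine ⟨τ ∘ₗ φ.toLinearMap, fun e he => ?_, fun a b => ?_⟩
  · have h3 := h1 (φ e) (he.map φ)
    rw [LinearMap.comp_apply]
    refine h3.trans ?_
    congr 2
    exact φ.symm_apply_apply e
  · simp only [LinearMap.comp_apply, AlgEquiv.toLinearMap_apply, map_mul, h2]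

end IsRankFunction

end

noncomputable section

/-! ### Images of continuous idempotents -/

namespace VecBundle

variable {X : Type u} [TopologicalSpace X]

/-! ### Continuous maps between sums and tensor products -/

theorem isContHom_tensor_map {E E' F F' : VecBundle.{u, v} X}
    {f : ∀ x, E.fiber x →ₗ[ℂ] E'.fiber x} {g : ∀ x, F.fiber x →ₗ[ℂ] F'.fiber x}
    (hf : IsContHom E E' f) (hg : IsContHom F F' g) :
    IsContHom (tensor E F) (tensor E' F') (fun x => TensorProduct.map (f x) (g x)) := by
  intro x x' i j
  have h1 : ContinuousOn (fun y => E'.coord x' y i.1 (f y (E.frame x y j.1)))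
      ((E.dom x ∩ F.dom x) ∩ (E'.dom x' ∩ F'.dom x')) :=
    ContinuousOn.mono (hf x x' i.1 j.1) fun y hy => ⟨hy.1.1, hy.2.1⟩
  have h2 : ContinuousOn (fun y => F'.coord x' y i.2 (g y (F.frame x y j.2)))
      ((E.dom x ∩ F.dom x) ∩ (E'.dom x' ∩ F'.dom x')) :=
    ContinuousOn.mono (hg x x' i.2 j.2) fun y hy => ⟨hy.1.2, hy.2.2⟩
  exact (h1.mul h2).congr fun y _ => rfl

theorem isContHom_inl (E F : VecBundle.{u, v} X) :
    IsContHom E (directSum E F) (fun _ => LinearMap.inl ℂ _ _) := by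
  intro x x' i j
  rcases i with i | i
  · exact (E.continuousOn_transition x' x i j).mono fun y hy => ⟨hy.2.1, hy.1⟩
  · refine (continuousOn_const (c := (0 : ℂ))).congr fun y _ => ?_
    exact map_zero (F.coord x' y i)

theorem isContHom_inr (E F : VecBundle.{u, v} X) :
    IsContHom F (directSum E F) (fun _ => LinearMap.inr ℂ _ _) := by
  intro x x' i j
  rcases i with i | i
  · refine (continuousOn_const (c := (0 : ℂ))).congr fun y _ => ?_
    exact map_zero (E.coord x' y i)
  · exact (F.continuousOn_transition x' x i j).mono fun y hy => ⟨hy.2.2, hy.1⟩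

theorem isContHom_fst (E F : VecBundle.{u, v} X) :
    IsContHom (directSum E F) E (fun _ => LinearMap.fst ℂ _ _) := by
  intro x x' i j
  rcases j with j | j
  · exact (E.continuousOn_transition x' x i j).mono fun y hy => ⟨hy.2, hy.1.1⟩
  · refine (continuousOn_const (c := (0 : ℂ))).congr fun y _ => ?_
    exact map_zero (E.coord x' y i)

theorem isContHom_snd (E F : VecBundle.{u, v} X) :
    IsContHom (directSum E F) F (fun _ => LinearMap.snd ℂ _ _) := by
  intro x x' i j
  rcases j with j | j
  · refine (continuousOn_const (c := (0 : ℂ))).congr fun y _ => ?_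
    exact map_zero (F.coord x' y i)
  · exact (F.continuousOn_transition x' x i j).mono fun y hy => ⟨hy.2, hy.1.2⟩

theorem isContHom_coprod {E F G : VecBundle.{u, v} X} {f : ∀ x, E.fiber x →ₗ[ℂ] G.fiber x}
    {g : ∀ x, F.fiber x →ₗ[ℂ] G.fiber x} (hf : IsContHom E G f) (hg : IsContHom F G g) :
    IsContHom (directSum E F) G (fun x => (f x).coprod (g x)) :=
  (hf.comp (isContHom_fst E F)).add (hg.comp (isContHom_snd E F))

theorem isContHom_prod {E F G : VecBundle.{u, v} X} {f : ∀ x, G.fiber x →ₗ[ℂ] E.fiber x}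
    {g : ∀ x, G.fiber x →ₗ[ℂ] F.fiber x} (hf : IsContHom G E f) (hg : IsContHom G F g) :
    IsContHom G (directSum E F) (fun x => (f x).prod (g x)) := by
  have h : (fun x => (f x).prod (g x)) =
      fun x => LinearMap.inl ℂ _ _ ∘ₗ f x + LinearMap.inr ℂ _ _ ∘ₗ g x := by
    funext x
    ext w
    · exact (add_zero (f x w)).symm
    · exact (zero_add (g x w)).symm
  rw [h]
  exact ((isContHom_inl E F).comp hf).add ((isContHom_inr E F).comp hg)

/-- Two continuous families of linear maps that are inverse to each other give an isomorphism. -/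
theorem isIso_of_inverse {E F : VecBundle.{u, v} X} {f : ∀ x, E.fiber x →ₗ[ℂ] F.fiber x}
    {g : ∀ x, F.fiber x →ₗ[ℂ] E.fiber x} (hf : IsContHom E F f) (hg : IsContHom F E g)
    (hfg : ∀ x, f x ∘ₗ g x = LinearMap.id) (hgf : ∀ x, g x ∘ₗ f x = LinearMap.id) : IsIso E F :=
  ⟨fun x => LinearEquiv.ofLinearMap (f x) (g x) (hfg x) (hgf x), hf, hg⟩

/-- The bundle `F` is (isomorphic to) the image of the idempotent endomorphism `P` of `V`. -/
def IsImage (F V : VecBundle.{u, v} X) (P : ∀ x, V.fiber x →ₗ[ℂ] V.fiber x) : Prop :=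
  ∃ (s : ∀ x, F.fiber x →ₗ[ℂ] V.fiber x) (r : ∀ x, V.fiber x →ₗ[ℂ] F.fiber x),
    IsContHom F V s ∧ IsContHom V F r ∧ (∀ x, r x ∘ₗ s x = LinearMap.id) ∧ ∀ x, s x ∘ₗ r x = P x

open Summand in
-- The maps are the inclusion of the summand and `P` corestricted to it. Coordinates on the summand
-- involve the inverse of `twist`, which is continuous where its determinant is nonzero, that is, on
-- the chart.
theorem isImage_ofProj {E : VecBundle.{u, v} X} {P : ∀ x, E.fiber x →ₗ[ℂ] E.fiber x}
    (W : ∀ x, Submodule ℂ (E.fiber x)) (hc : IsContHom E E P)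
    (hP : ∀ x, LinearMap.IsProj (W x) (P x)) : IsImage (ofProj W hc hP) E P := by
  have : ∀ x, Module.Finite ℂ (E.fiber x) := fun x =>
    Module.Finite.of_basis (E.basis x x (E.mem_dom x))
  refine ⟨fun x => (W x).subtype, fun x => (P x).codRestrict (W x) (hP x).map_mem, ?_, ?_, ?_, ?_⟩
  · intro x x' i j
    have h : ContinuousOn (fun y => E.coord x' y i (P y (ofVec E x y
        (vec E x x (Module.finBasis ℂ (W x) j))))) (E.dom x ∩ E.dom x') := by
      simp only [ofVec, map_sum, map_smul, smul_eq_mul]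
      exact continuousOn_finsetSum _ fun l _ => continuousOn_const.mul (hc x x' i l)
    exact h.mono fun y hy => ⟨hy.1.1, hy.2⟩
  · intro x x' i j
    have hW : ContinuousOn (fun y => vec E x' y (P y (E.frame x y j)))
        (E.dom x ∩ E.dom x') := continuousOn_pi.2 fun k => hc x x' k j
    have hI : ContinuousOn (fun y => (twist E P x' y)⁻¹)
        (E.dom x' ∩ (fun y => (twist E P x' y).det) ⁻¹' {0}ᶜ) := by
      have ht := (continuousOn_twist hc x').mono
        (Set.inter_subset_left (t := (fun y => (twist E P x' y).det) ⁻¹' {0}ᶜ))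
      simp only [Matrix.inv_def, Ring.inverse_eq_inv']
      exact ((continuous_id.matrix_det.comp_continuousOn ht).inv₀ fun y hy => hy.2).smul
        (continuous_id.matrix_adjugate.comp_continuousOn ht)
    have hM : ContinuousOn (fun y => (twist E P x' y)⁻¹.mulVec
        (vec E x' y (P y (E.frame x y j))))
        (E.dom x ∩ (E.dom x' ∩ (fun y => (twist E P x' y).det) ⁻¹' {0}ᶜ)) := by
      refine continuousOn_pi.2 fun k => ?_
      refine continuousOn_finsetSum _ fun l _ => ContinuousOn.mul ?_ ?_
      · exact (continuousOn_pi.1 (continuousOn_pi.1 hI k) l).mono Set.inter_subset_right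
      · exact (continuousOn_pi.1 hW l).mono fun y hy => ⟨hy.1, hy.2.1⟩
    have hL : Continuous ((Module.finBasis ℂ (W x')).coord i ∘ₗ
        (P x').codRestrict (W x') (hP x').map_mem ∘ₗ
        Fintype.linearCombination ℂ (E.frame x' x')) :=
      LinearMap.continuous_of_finiteDimensional _
    exact hL.comp_continuousOn hM
  · intro x
    exact LinearMap.ext fun w => Subtype.ext ((hP x).map_id _ w.2)
  · intro x
    rfl

/-! ### Uniqueness, sums and products of images -/

theorem IsImage.congr {F V : VecBundle.{u, v} X} {P Q : ∀ x, V.fiber x →ₗ[ℂ] V.fiber x}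
    (h : IsImage F V P) (hPQ : ∀ x, P x = Q x) : IsImage F V Q := by
  obtain rfl : P = Q := funext hPQ
  exact h

theorem exists_isImage {V : VecBundle.{u, v} X} {P : ∀ x, Module.End ℂ (V.fiber x)}
    (hc : IsContHom V V P) (hP : ∀ x, IsIdempotentElem (P x)) : ∃ F, IsImage F V P :=
  ⟨_, isImage_ofProj (fun x => LinearMap.range (P x)) hc
    fun x => (LinearMap.isProj_range_iff_isIdempotentElem (P x)).2 (hP x)⟩

/-- Equivalent idempotents have isomorphic images. -/
theorem IsImage.isIso {F F' V V' : VecBundle.{u, v} X} {P : ∀ x, V.fiber x →ₗ[ℂ] V.fiber x}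
    {P' : ∀ x, V'.fiber x →ₗ[ℂ] V'.fiber x} (h : IsImage F V P) (h' : IsImage F' V' P')
    {a : ∀ x, V.fiber x →ₗ[ℂ] V'.fiber x} {b : ∀ x, V'.fiber x →ₗ[ℂ] V.fiber x}
    (ha : IsContHom V V' a) (hb : IsContHom V' V b) (hba : ∀ x, b x ∘ₗ a x = P x)
    (hab : ∀ x, a x ∘ₗ b x = P' x) : IsIso F F' := by
  obtain ⟨s, r, hs, hr, hrs, hsr⟩ := h
  obtain ⟨s', r', hs', hr', hrs', hsr'⟩ := h'
  refine isIso_of_inverse (hr'.comp (ha.comp hs)) (hr.comp (hb.comp hs')) ?_ ?_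
  · intro x
    ext w
    have h1 : ∀ z, s x (r x z) = b x (a x z) := fun z =>
      LinearMap.congr_fun ((hsr x).trans (hba x).symm) z
    have h2 : ∀ z, a x (b x z) = s' x (r' x z) := fun z =>
      LinearMap.congr_fun ((hab x).trans (hsr' x).symm) z
    have h3 : ∀ z, r' x (s' x z) = z := fun z => LinearMap.congr_fun (hrs' x) z
    simp only [LinearMap.comp_apply, h1, h2, h3, LinearMap.id_apply]
  · intro x
    ext w
    have h1 : ∀ z, s' x (r' x z) = a x (b x z) := fun z =>
      LinearMap.congr_fun ((hsr' x).trans (hab x).symm) z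
    have h2 : ∀ z, b x (a x z) = s x (r x z) := fun z =>
      LinearMap.congr_fun ((hba x).trans (hsr x).symm) z
    have h3 : ∀ z, r x (s x z) = z := fun z => LinearMap.congr_fun (hrs x) z
    simp only [LinearMap.comp_apply, h1, h2, h3, LinearMap.id_apply]

theorem IsImage.isContHom {F V : VecBundle.{u, v} X} {P : ∀ x, V.fiber x →ₗ[ℂ] V.fiber x}
    (h : IsImage F V P) : IsContHom V V P := by
  obtain ⟨s, r, hs, hr, hrs, hsr⟩ := h
  obtain rfl : (fun x => s x ∘ₗ r x) = P := funext hsr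
  exact hs.comp hr

theorem IsImage.comp_self {F V : VecBundle.{u, v} X} {P : ∀ x, V.fiber x →ₗ[ℂ] V.fiber x}
    (h : IsImage F V P) (x : X) : P x ∘ₗ P x = P x := by
  obtain ⟨s, r, hs, hr, hrs, hsr⟩ := h
  rw [← hsr x, LinearMap.comp_assoc, ← LinearMap.comp_assoc (r x), hrs, LinearMap.id_comp]

/-- An idempotent is equivalent to itself, by way of itself in both directions. -/
theorem IsImage.unique {F F' V : VecBundle.{u, v} X} {P : ∀ x, V.fiber x →ₗ[ℂ] V.fiber x}
    (h : IsImage F V P) (h' : IsImage F' V P) : IsIso F F' :=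
  h.isIso h' h.isContHom h.isContHom h.comp_self h.comp_self

theorem IsImage.directSum {F F' V : VecBundle.{u, v} X} {P P' : ∀ x, V.fiber x →ₗ[ℂ] V.fiber x}
    (h : IsImage F V P) (h' : IsImage F' V P') (hPP' : ∀ x, P x ∘ₗ P' x = 0)
    (hP'P : ∀ x, P' x ∘ₗ P x = 0) : IsImage (directSum F F') V (fun x => P x + P' x) := by
  obtain ⟨s, r, hs, hr, hrs, hsr⟩ := h
  obtain ⟨s', r', hs', hr', hrs', hsr'⟩ := h'
  refine ⟨_, _, isContHom_coprod hs hs', isContHom_prod hr hr', ?_, ?_⟩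
  · intro x
    -- Since `r s = 1` and `r' s' = 1`, one has `r s' = r (s r)(s' r') s' = r P P' s'`, which
    -- vanishes by orthogonality.
    have h1 : r x ∘ₗ s' x = 0 := by
      have h2 : r x ∘ₗ (P x ∘ₗ P' x) ∘ₗ s' x = r x ∘ₗ s' x := by
        ext w
        rw [← hsr, ← hsr']
        have h3 : ∀ z, r' x (s' x z) = z := fun z => LinearMap.congr_fun (hrs' x) z
        have h4 : ∀ z, r x (s x z) = z := fun z => LinearMap.congr_fun (hrs x) z
        simp only [LinearMap.comp_apply, h3, h4]
      rw [← h2, hPP' x, LinearMap.zero_comp, LinearMap.comp_zero]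
    have h1' : r' x ∘ₗ s x = 0 := by
      have h2 : r' x ∘ₗ (P' x ∘ₗ P x) ∘ₗ s x = r' x ∘ₗ s x := by
        ext w
        rw [← hsr, ← hsr']
        have h3 : ∀ z, r' x (s' x z) = z := fun z => LinearMap.congr_fun (hrs' x) z
        have h4 : ∀ z, r x (s x z) = z := fun z => LinearMap.congr_fun (hrs x) z
        simp only [LinearMap.comp_apply, h3, h4]
      rw [← h2, hP'P x, LinearMap.zero_comp, LinearMap.comp_zero]
    refine LinearMap.ext fun w => Prod.ext ?_ ?_
    · change r x (s x w.1 + s' x w.2) = w.1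
      rw [map_add]
      exact (congrArg₂ _ (LinearMap.congr_fun (hrs x) w.1) (LinearMap.congr_fun h1 w.2)).trans
        (add_zero _)
    · change r' x (s x w.1 + s' x w.2) = w.2
      rw [map_add]
      exact (congrArg₂ _ (LinearMap.congr_fun h1' w.1) (LinearMap.congr_fun (hrs' x) w.2)).trans
        (zero_add _)
  · intro x
    exact (congrArg₂ (· + ·) (hsr x) (hsr' x) :)

theorem IsImage.tensor {F F' V V' : VecBundle.{u, v} X} {P : ∀ x, V.fiber x →ₗ[ℂ] V.fiber x}
    {P' : ∀ x, V'.fiber x →ₗ[ℂ] V'.fiber x} (h : IsImage F V P) (h' : IsImage F' V' P') :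
    IsImage (tensor F F') (tensor V V') (fun x => TensorProduct.map (P x) (P' x)) := by
  obtain ⟨s, r, hs, hr, hrs, hsr⟩ := h
  obtain ⟨s', r', hs', hr', hrs', hsr'⟩ := h'
  refine ⟨_, _, isContHom_tensor_map hs hs', isContHom_tensor_map hr hr', ?_, ?_⟩
  · intro x
    refine (TensorProduct.map_comp _ _ _ _).symm.trans ?_
    rw [hrs, hrs']
    exact TensorProduct.map_id
  · intro x
    refine (TensorProduct.map_comp _ _ _ _).symm.trans ?_
    rw [hsr, hsr']

/-- The class of the image of an idempotent endomorphism (and zero for other endomorphisms). -/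
def imageClass (V : VecBundle.{u, v} X) (P : ∀ x, V.fiber x →ₗ[ℂ] V.fiber x) : KTheory.{u, v} X :=
  open Classical in if h : ∃ F, IsImage F V P then h.choose.kclass else 0

/-! ### Classes of images in K-theory -/

theorem IsIso.kclass_eq {E F : VecBundle.{u, v} X} (h : IsIso E F) : E.kclass = F.kclass :=
  congrArg Algebra.GrothendieckAddGroup.of (Quotient.sound h)

theorem kclass_directSum (E F : VecBundle.{u, v} X) :
    (directSum E F).kclass = E.kclass + F.kclass :=
  map_add Algebra.GrothendieckAddGroup.of (VectClass.mk E) (VectClass.mk F)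

theorem kclass_tensor (E F : VecBundle.{u, v} X) :
    (tensor E F).kclass = E.kclass * F.kclass :=
  (GrothendieckRing.mulHom_of (VectClass.mk E) (VectClass.mk F)).symm

theorem IsImage.imageClass_eq {F V : VecBundle.{u, v} X} {P : ∀ x, V.fiber x →ₗ[ℂ] V.fiber x}
    (h : IsImage F V P) : V.imageClass P = F.kclass := by
  have h' : ∃ F, IsImage F V P := ⟨F, h⟩
  rw [imageClass, dif_pos h']
  exact (h'.choose_spec.unique h).kclass_eq

/-- Images of orthogonal idempotents form a direct sum. The actions of `b` and `a`, continuous in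
the base point, give mutually inverse isomorphisms between the images of `a * b` and `b * a`. -/
theorem isRankFunction_imageClass {A : Type*} [Ring A] [Algebra ℂ A] {V : VecBundle.{u, v} X}
    (ρ : ∀ x, A →ₐ[ℂ] Module.End ℂ (V.fiber x)) (hρ : ∀ a, IsContHom V V (fun x => ρ x a)) :
    IsRankFunction (fun a => V.imageClass (fun x => ρ x a)) where
  add e f he hf hef hfe := by
    obtain ⟨E, hE⟩ := exists_isImage (hρ e) fun x => he.map (ρ x)
    obtain ⟨F, hF⟩ := exists_isImage (hρ f) fun x => hf.map (ρ x)
    have h := hE.directSum hF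
      (fun x => by rw [← Module.End.mul_eq_comp, ← map_mul, hef, map_zero])
      (fun x => by rw [← Module.End.mul_eq_comp, ← map_mul, hfe, map_zero])
    rw [hE.imageClass_eq, hF.imageClass_eq, ← kclass_directSum, ← h.imageClass_eq]
    simp only [map_add]
  comm a b hab hba := by
    obtain ⟨E, hE⟩ := exists_isImage (hρ (a * b)) fun x => hab.map (ρ x)
    obtain ⟨F, hF⟩ := exists_isImage (hρ (b * a)) fun x => hba.map (ρ x)
    rw [hE.imageClass_eq, hF.imageClass_eq]
    exact (hE.isIso hF (hρ b) (hρ a) (fun x => (map_mul (ρ x) a b).symm)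
      (fun x => (map_mul (ρ x) b a).symm)).kclass_eq

end VecBundle

/-! ### The trace of an equivariant bundle -/

namespace GVecBundle

variable {X : Type u} [TopologicalSpace X] {G : Type*} [Group G]

/-- The action of the group algebra on the fibres of an equivariant bundle. -/
def algAction (V : GVecBundle.{u, v} G X) (x : X) :
    MonoidAlgebra ℂ G →ₐ[ℂ] Module.End ℂ (V.fiber x) :=
  (V.action x).asAlgebraHom

theorem algAction_of (V : GVecBundle.{u, v} G X) (x : X) (g : G) :
    V.algAction x (MonoidAlgebra.of ℂ G g) = V.action x g :=
  Representation.asAlgebraHom_of _ g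

theorem isContHom_algAction (V : GVecBundle.{u, v} G X) (a : MonoidAlgebra ℂ G) :
    VecBundle.IsContHom V.toVecBundle V.toVecBundle (fun x => V.algAction x a) := by
  induction a using MonoidAlgebra.induction_on with
  | of g =>
    simp only [algAction_of]
    exact V.isContHom_action g
  | add a b ha hb =>
    simp only [map_add]
    exact ha.add hb
  | smul c a ha =>
    simp only [map_smul]
    exact ha.smul c

theorem exists_trace [Finite G] (V : GVecBundle.{u, v} G X) :
    ∃ τ : MonoidAlgebra ℂ G →ₗ[ℂ] ℂ ⊗[ℤ] KTheory.{u, v} X,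
      (∀ e, IsIdempotentElem e →
        τ e = 1 ⊗ₜ V.toVecBundle.imageClass (fun x => V.algAction x e)) ∧
      ∀ a b, τ (a * b) = τ (b * a) := by
  -- The hypothesis of Maschke's theorem, which makes the group algebra semisimple.
  have : NeZero (Nat.card G : ℂ) := ⟨by exact_mod_cast Nat.card_pos.ne'⟩
  have : FiniteDimensional ℂ (MonoidAlgebra ℂ G) :=
    Module.Finite.equiv (MonoidAlgebra.coeffLinearEquiv ℂ (S := ℂ) (M := G)).symm
  exact (VecBundle.isRankFunction_imageClass V.algAction V.isContHom_algAction).exists_trace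

/-- The trace of an element of the group algebra on an equivariant bundle; it sends an idempotent to
the class of its image. -/
def trace [Finite G] (V : GVecBundle.{u, v} G X) :
    MonoidAlgebra ℂ G →ₗ[ℂ] ℂ ⊗[ℤ] KTheory.{u, v} X :=
  V.exists_trace.choose

variable [Finite G] (V : GVecBundle.{u, v} G X)

theorem trace_mul_comm (a b : MonoidAlgebra ℂ G) : V.trace (a * b) = V.trace (b * a) :=
  V.exists_trace.choose_spec.2 a b

theorem trace_of_isImage {F : VecBundle.{u, v} X} {e : MonoidAlgebra ℂ G}
    (he : IsIdempotentElem e)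
    (h : VecBundle.IsImage F V.toVecBundle (fun x => V.algAction x e)) :
    V.trace e = 1 ⊗ₜ F.kclass := by
  rw [← h.imageClass_eq]
  exact V.exists_trace.choose_spec.1 e he

theorem exists_trace_eq {e : MonoidAlgebra ℂ G} (he : IsIdempotentElem e) :
    ∃ F : VecBundle.{u, v} X, VecBundle.IsImage F V.toVecBundle (fun x => V.algAction x e) ∧
      V.trace e = 1 ⊗ₜ F.kclass := by
  obtain ⟨F, hF⟩ := VecBundle.exists_isImage (V.isContHom_algAction e) fun x => he.map _
  exact ⟨F, hF, V.trace_of_isImage he hF⟩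

end GVecBundle

end

noncomputable section

/-! ### The Atiyah–Segal map as a trace -/

/-- The projection to the eigenspace for `ξ` of an element `g` of order `N`, in the group
algebra. -/
def eigenIdempotent {G : Type*} [Group G] (g : G) (ξ : ℂ) : MonoidAlgebra ℂ G :=
  (orderOf g : ℂ)⁻¹ • ∑ k ∈ Finset.range (orderOf g), (ξ ^ k)⁻¹ • MonoidAlgebra.of ℂ G (g ^ k)

theorem of_mul_eigenIdempotent {G : Type*} [Group G] (g : G) {ξ : ℂ} (hξ : ξ ≠ 0)
    (h : ξ ^ orderOf g = 1) :
    MonoidAlgebra.of ℂ G g * eigenIdempotent g ξ = ξ • eigenIdempotent g ξ := by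
  simp only [eigenIdempotent, mul_smul_comm, Finset.mul_sum]
  rw [smul_comm ξ]
  congr 1
  -- The terms for `k = 0` and `k = orderOf g` agree, so shifting the index by one leaves the sum
  -- unchanged.
  have hs := Finset.sum_range_succ' (fun k => (ξ ^ k)⁻¹ • MonoidAlgebra.of ℂ G (g ^ k)) (orderOf g)
  rw [Finset.sum_range_succ, pow_orderOf_eq_one, h] at hs
  simp only [pow_zero] at hs
  rw [add_right_cancel hs, Finset.smul_sum]
  refine Finset.sum_congr rfl fun k _ => ?_
  rw [← map_mul, ← pow_succ', smul_smul]
  congr 1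
  rw [pow_succ]
  field_simp

/-- As `g ^ k` acts on the element by `ξ ^ k`, each of the `orderOf g` terms of the left factor
reproduces the right factor. -/
theorem isIdempotentElem_eigenIdempotent {G : Type*} [Group G] [Finite G] (g : G) {ξ : ℂ}
    (h : ξ ^ orderOf g = 1) : IsIdempotentElem (eigenIdempotent g ξ) := by
  have hN : 0 < orderOf g := orderOf_pos g
  have hξ : ξ ≠ 0 := by
    rintro rfl
    rw [zero_pow hN.ne'] at h
    exact zero_ne_one h
  have hk : ∀ k : ℕ, MonoidAlgebra.of ℂ G (g ^ k) * eigenIdempotent g ξ =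
      ξ ^ k • eigenIdempotent g ξ := by
    intro k
    induction k with
    | zero => rw [pow_zero, pow_zero, map_one, one_mul, one_smul]
    | succ k ih => rw [pow_succ, map_mul, mul_assoc, of_mul_eigenIdempotent g hξ h, mul_smul_comm,
        ih, smul_smul, pow_succ, mul_comm]
  have hN' : (orderOf g : ℂ) ≠ 0 := by exact_mod_cast hN.ne'
  have h1 : ∀ k ∈ Finset.range (orderOf g), ((ξ ^ k)⁻¹ • MonoidAlgebra.of ℂ G (g ^ k)) *
      eigenIdempotent g ξ = eigenIdempotent g ξ := by
    intro k _
    rw [smul_mul_assoc, hk, smul_smul, inv_mul_cancel₀ (pow_ne_zero k hξ), one_smul]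
  rw [IsIdempotentElem]
  conv_lhs => rw [eigenIdempotent.eq_def g ξ, smul_mul_assoc, Finset.sum_mul]
  rw [← eigenIdempotent.eq_def g ξ, Finset.sum_congr rfl h1, Finset.sum_const, Finset.card_range,
    ← Nat.cast_smul_eq_nsmul ℂ, smul_smul, inv_mul_cancel₀ hN', one_smul]

/-- Fourier inversion on the cyclic group generated by `g`; this is the spectral decomposition of
`g` inside the group algebra. -/
theorem sum_smul_eigenIdempotent {G : Type*} [Group G] [Finite G] (g : G) :
    ∑ ξ ∈ Polynomial.nthRootsFinset (orderOf g) (1 : ℂ), ξ • eigenIdempotent g ξ =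
      MonoidAlgebra.of ℂ G g := by
  set N := orderOf g with hNdef
  have hN : 0 < N := orderOf_pos g
  have hN' : (N : ℂ) ≠ 0 := by exact_mod_cast hN.ne'
  have hζ := Complex.isPrimitiveRoot_exp N hN.ne'
  set ζ := Complex.exp (2 * Real.pi * Complex.I / N)
  have : NeZero N := ⟨hN.ne'⟩
  -- The exponent is reduced modulo `N` so that it lies in `Finset.range N` also when `N = 1`, where
  -- it is `0`.
  have hmod : ζ ^ (1 % N) = ζ := by
    rw [hζ.eq_orderOf, pow_mod_orderOf, pow_one]
  have hζ0 : ζ ≠ 0 := hζ.ne_zero hN.ne'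
  have key : ∀ f : ℂ → MonoidAlgebra ℂ G, ∑ ξ ∈ Polynomial.nthRootsFinset N (1 : ℂ), f ξ =
      ∑ l ∈ Finset.range N, f (ζ ^ l) := by
    intro f
    symm
    refine Finset.sum_bij (fun l _ => ζ ^ l) ?_ ?_ ?_ (fun _ _ => rfl)
    · intro l _
      rw [Polynomial.mem_nthRootsFinset hN, ← pow_mul, mul_comm, pow_mul, hζ.pow_eq_one, one_pow]
    · intro a ha b hb hab
      exact hζ.pow_inj (Finset.mem_range.1 ha) (Finset.mem_range.1 hb) hab
    · intro ξ hξ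
      obtain ⟨l, hl, rfl⟩ := hζ.eq_pow_of_pow_eq_one ((Polynomial.mem_nthRootsFinset hN _).1 hξ)
      exact ⟨l, Finset.mem_range.2 hl, rfl⟩
  -- Orthogonality of characters: a geometric sum with ratio `ζ ^ (1 - k)`.
  have hsum : ∀ k ∈ Finset.range N, ∑ l ∈ Finset.range N, ζ ^ l * ((ζ ^ l) ^ k)⁻¹ =
      if k = 1 % N then (N : ℂ) else 0 := by
    intro k hk
    have h1 : ∀ l, ζ ^ l * ((ζ ^ l) ^ k)⁻¹ = (ζ * (ζ ^ k)⁻¹) ^ l := by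
      intro l
      rw [mul_pow, inv_pow, ← pow_mul, ← pow_mul, mul_comm k]
    simp only [h1]
    split_ifs with h
    · have h2 : ζ ^ k = ζ := by
        rw [h, hmod]
      rw [h2, mul_inv_cancel₀ hζ0]
      simp
    · have h2 : ζ * (ζ ^ k)⁻¹ ≠ 1 := by
        intro h3
        rw [mul_inv_eq_one₀ (pow_ne_zero _ hζ0)] at h3
        apply h
        refine hζ.pow_inj (Finset.mem_range.1 hk) (Nat.mod_lt _ hN) ?_
        rw [← h3, hmod]
      rw [geom_sum_eq h2, mul_pow, inv_pow, ← pow_mul, mul_comm k, pow_mul, hζ.pow_eq_one]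
      simp
  rw [key]
  simp only [eigenIdempotent, ← hNdef, Finset.smul_sum, smul_smul]
  rw [Finset.sum_comm]
  have h3 : ∀ k ∈ Finset.range N, ∑ l ∈ Finset.range N,
      (ζ ^ l * ((N : ℂ)⁻¹ * ((ζ ^ l) ^ k)⁻¹)) • MonoidAlgebra.of ℂ G (g ^ k) =
      if k = 1 % N then MonoidAlgebra.of ℂ G (g ^ k) else 0 := by
    intro k hk
    rw [← Finset.sum_smul]
    have h4 : ∑ l ∈ Finset.range N, ζ ^ l * ((N : ℂ)⁻¹ * ((ζ ^ l) ^ k)⁻¹) =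
        (N : ℂ)⁻¹ * ∑ l ∈ Finset.range N, ζ ^ l * ((ζ ^ l) ^ k)⁻¹ := by
      rw [Finset.mul_sum]
      exact Finset.sum_congr rfl fun l _ => by ring
    rw [h4, hsum k hk]
    split_ifs with h
    · rw [inv_mul_cancel₀ hN', one_smul]
    · rw [mul_zero, zero_smul]
  rw [Finset.sum_congr rfl h3, Finset.sum_ite_eq' , if_pos (Finset.mem_range.2 (Nat.mod_lt _ hN)),
    hNdef, pow_mod_orderOf, pow_one]

namespace GVecBundle

variable {X : Type u} [TopologicalSpace X] {G : Type*} [Group G] [Finite G]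

theorem isImage_eigenbundle (V : GVecBundle.{u, v} G X) (g : G) {ξ : ℂ} (h : ξ ^ orderOf g = 1) :
    VecBundle.IsImage (V.eigenbundle g ξ) V.toVecBundle
      (fun x => V.algAction x (eigenIdempotent g ξ)) := by
  refine (VecBundle.isImage_ofProj _ (V.isContHom_eigenProj g ξ)
    (V.isProj_eigenProj g ξ)).congr fun x => ?_
  simp only [eigenProj, if_pos h, eigenIdempotent, map_smul, map_sum, algAction_of]

/-- Apply the linear map `trace` to `g = ∑ ξ e_ξ`; the image of `e_ξ` is the eigenbundle. -/
theorem atiyahSegal_eq_trace (V : GVecBundle.{u, v} G X) (g : G) :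
    V.atiyahSegal g = V.trace (MonoidAlgebra.of ℂ G g) := by
  rw [atiyahSegal, ← sum_smul_eigenIdempotent, map_sum]
  refine Finset.sum_congr rfl fun ξ hξ => ?_
  have h := (Polynomial.mem_nthRootsFinset (orderOf_pos g) _).1 hξ
  rw [map_smul, V.trace_of_isImage (isIdempotentElem_eigenIdempotent g h)
    (V.isImage_eigenbundle g h), TensorProduct.smul_tmul', smul_eq_mul, mul_one]

end GVecBundle

end

noncomputable section

/-! ### Multiplicativity of the trace -/

namespace VecBundle

variable {X : Type u} [TopologicalSpace X]

theorem IsImage.transport {F V U : VecBundle.{u, v} X} {P : ∀ x, V.fiber x →ₗ[ℂ] V.fiber x}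
    (h : IsImage F V P) {Q : ∀ x, U.fiber x →ₗ[ℂ] U.fiber x}
    (m : ∀ x, V.fiber x ≃ₗ[ℂ] U.fiber x) (hm : IsContHom V U (fun x => (m x).toLinearMap))
    (hm' : IsContHom U V (fun x => (m x).symm.toLinearMap))
    (hPQ : ∀ x w, m x (P x w) = Q x (m x w)) : IsImage F U Q := by
  obtain ⟨s, r, hs, hr, hrs, hsr⟩ := h
  refine ⟨_, _, hm.comp hs, hr.comp hm', ?_, ?_⟩
  · intro x
    ext w
    have h1 : r x (s x w) = w := LinearMap.congr_fun (hrs x) w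
    simp [h1]
  · intro x
    ext w
    have h1 : s x (r x ((m x).symm w)) = P x ((m x).symm w) := LinearMap.congr_fun (hsr x) _
    simp [h1, hPQ]

end VecBundle

namespace GVecBundle

variable {X : Type u} [TopologicalSpace X] {G H K : Type*} [Group G] [Finite G] [Group H] [Finite H]
  [Group K] [Finite K]

/-- Idempotents span the group algebra, because each group element is a combination of its spectral
projections. Linear identities for `trace` can thus be checked where its values are classes of
bundles. -/
theorem _root_.MonoidAlgebra.induction_on_idempotents {p : MonoidAlgebra ℂ G → Prop}
    (hidem : ∀ e, IsIdempotentElem e → p e) (hadd : ∀ a b, p a → p b → p (a + b))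
    (hsmul : ∀ (c : ℂ) a, p a → p (c • a)) (a : MonoidAlgebra ℂ G) : p a := by
  induction a using MonoidAlgebra.induction_on with
  | of g =>
    rw [← sum_smul_eigenIdempotent]
    have h0 : p 0 := hidem 0 IsIdempotentElem.zero
    refine Finset.sum_induction _ p hadd h0 fun ξ hξ => hsmul _ _ (hidem _ ?_)
    exact isIdempotentElem_eigenIdempotent g
      ((Polynomial.mem_nthRootsFinset (orderOf_pos g) _).1 hξ)
  | add a b ha hb => exact hadd a b ha hb
  | smul c a ha => exact hsmul c a ha

/-- The trace of an exterior tensor product is the product of the traces. -/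
theorem trace_mul_trace (V : GVecBundle.{u, v} G X) (W : GVecBundle.{u, v} H X)
    (U : GVecBundle.{u, v} K X) (φ : G →* K) (ψ : H →* K) (hφψ : ∀ g h, Commute (φ g) (ψ h))
    (m : ∀ x, V.fiber x ⊗[ℂ] W.fiber x ≃ₗ[ℂ] U.fiber x)
    (hm : VecBundle.IsContHom (VecBundle.tensor V.toVecBundle W.toVecBundle) U.toVecBundle
      (fun x => (m x).toLinearMap))
    (hm' : VecBundle.IsContHom U.toVecBundle (VecBundle.tensor V.toVecBundle W.toVecBundle)
      (fun x => (m x).symm.toLinearMap))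
    (hmφψ : ∀ x g h w, m x (TensorProduct.map (V.action x g) (W.action x h) w) =
      U.action x (φ g) (U.action x (ψ h) (m x w)))
    (a : MonoidAlgebra ℂ G) (b : MonoidAlgebra ℂ H) :
    V.trace a * W.trace b =
      U.trace (MonoidAlgebra.mapDomainAlgHom ℂ ℂ φ a * MonoidAlgebra.mapDomainAlgHom ℂ ℂ ψ b) := by
  -- Commutation is what makes the product of the images of two idempotents idempotent.
  have hcomm : ∀ a b, Commute (MonoidAlgebra.mapDomainAlgHom ℂ ℂ φ a)
      (MonoidAlgebra.mapDomainAlgHom ℂ ℂ ψ b) := by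
    intro a b
    induction a using MonoidAlgebra.induction_on with
    | of g =>
      induction b using MonoidAlgebra.induction_on with
      | of h =>
        simp only [MonoidAlgebra.of_apply, MonoidAlgebra.mapDomainAlgHom_apply,
          MonoidAlgebra.mapDomain_single]
        rw [Commute, SemiconjBy, MonoidAlgebra.single_mul_single, MonoidAlgebra.single_mul_single,
          (hφψ g h).eq]
      | add a b ha hb => rw [map_add]; exact ha.add_right hb
      | smul c a ha => rw [map_smul]; exact ha.smul_right c
    | add a b ha hb => rw [map_add]; exact ha.add_left hb
    | smul c a ha => rw [map_smul]; exact ha.smul_left c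
  have hact : ∀ a b x w, m x (TensorProduct.map (V.algAction x a) (W.algAction x b) w) =
      U.algAction x (MonoidAlgebra.mapDomainAlgHom ℂ ℂ φ a *
        MonoidAlgebra.mapDomainAlgHom ℂ ℂ ψ b) (m x w) := by
    intro a b x w
    induction a using MonoidAlgebra.induction_on with
    | of g =>
      induction b using MonoidAlgebra.induction_on with
      | of h =>
        rw [algAction_of, algAction_of, hmφψ, ← U.algAction_of, ← U.algAction_of,
          ← Module.End.mul_apply, ← map_mul]
        simp only [MonoidAlgebra.of_apply, MonoidAlgebra.mapDomainAlgHom_apply,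
          MonoidAlgebra.mapDomain_single]
      | add a b ha hb =>
        rw [map_add, map_add, TensorProduct.map_add_right, LinearMap.add_apply, map_add, ha, hb,
          mul_add, map_add, LinearMap.add_apply]
      | smul c a ha =>
        rw [map_smul, map_smul, TensorProduct.map_smul_right, LinearMap.smul_apply, map_smul, ha,
          mul_smul_comm, map_smul, LinearMap.smul_apply]
    | add a b ha hb =>
      rw [map_add, map_add, TensorProduct.map_add_left, LinearMap.add_apply, map_add, ha, hb,
        add_mul, map_add, LinearMap.add_apply]
    | smul c a ha =>
      rw [map_smul, map_smul, TensorProduct.map_smul_left, LinearMap.smul_apply, map_smul, ha,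
        smul_mul_assoc, map_smul, LinearMap.smul_apply]
  -- Both sides are bilinear. For idempotents `e` and `f` with images `E` and `F`, the image of
  -- their product in `U` is `E ⊗ F`.
  induction a using MonoidAlgebra.induction_on_idempotents with
  | hadd a a' ha ha' => rw [map_add, map_add, add_mul, add_mul, ha, ha', map_add]
  | hsmul c a ha => rw [map_smul, map_smul, smul_mul_assoc, smul_mul_assoc, ha, map_smul]
  | hidem e he =>
    induction b using MonoidAlgebra.induction_on_idempotents with
    | hadd b b' hb hb' => rw [map_add, map_add, mul_add, mul_add, hb, hb', map_add]
    | hsmul c b hb => rw [map_smul, map_smul, mul_smul_comm, mul_smul_comm, hb, map_smul]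
    | hidem f hf =>
      obtain ⟨E, hE, hE'⟩ := V.exists_trace_eq he
      obtain ⟨F, hF, hF'⟩ := W.exists_trace_eq hf
      have h1 := (hE.tensor hF).transport m hm hm' (hact e f)
      have h2 : IsIdempotentElem (MonoidAlgebra.mapDomainAlgHom ℂ ℂ φ e *
          MonoidAlgebra.mapDomainAlgHom ℂ ℂ ψ f) :=
        IsIdempotentElem.mul_of_commute (hcomm e f) (he.map _) (hf.map _)
      rw [hE', hF', U.trace_of_isImage h2 h1, VecBundle.kclass_tensor,
        Algebra.TensorProduct.tmul_mul_tmul, one_mul]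

end GVecBundle

/-! ### Tensor powers -/

/-- The embedding of `S_i × S_j` in `S_{i+j}`. -/
def permSum (i j : ℕ) : Equiv.Perm (Fin i) × Equiv.Perm (Fin j) →* Equiv.Perm (Fin (i + j)) :=
  finSumFinEquiv.permCongrHom.toMonoidHom.comp (Equiv.Perm.sumCongrHom _ _)

@[simp]
theorem permSum_castAdd {i j : ℕ} (σ : Equiv.Perm (Fin i) × Equiv.Perm (Fin j)) (k : Fin i) :
    permSum i j σ (Fin.castAdd j k) = Fin.castAdd j (σ.1 k) := by
  simp [permSum, Equiv.permCongrHom, Equiv.permCongr_apply]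

@[simp]
theorem permSum_natAdd {i j : ℕ} (σ : Equiv.Perm (Fin i) × Equiv.Perm (Fin j)) (k : Fin j) :
    permSum i j σ (Fin.natAdd i k) = Fin.natAdd i (σ.2 k) := by
  simp [permSum, Equiv.permCongrHom, Equiv.permCongr_apply]

namespace VecBundle

variable {X : Type u} [TopologicalSpace X]

/-- The isomorphism `E^{⊗ i} ⊗ E^{⊗ j} ≅ E^{⊗ (i + j)}`. -/
def tensorPowerAdd (M : Type*) [AddCommGroup M] [Module ℂ M] (i j : ℕ) :
    (⨂[ℂ] _ : Fin i, M) ⊗[ℂ] (⨂[ℂ] _ : Fin j, M) ≃ₗ[ℂ] ⨂[ℂ] _ : Fin (i + j), M :=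
  TensorPower.mulEquiv

theorem tensorPowerAdd_tmul {M : Type*} [AddCommGroup M] [Module ℂ M] {i j : ℕ} (a : Fin i → M)
    (b : Fin j → M) :
    tensorPowerAdd M i j (PiTensorProduct.tprod ℂ a ⊗ₜ PiTensorProduct.tprod ℂ b) =
      PiTensorProduct.tprod ℂ (Fin.append a b) :=
  TensorPower.tprod_mul_tprod ℂ a b

theorem tensorPowerAdd_frame (E : VecBundle.{u, v} X) (i j : ℕ) (x y : X)
    (k : (Fin i → E.idx x) × (Fin j → E.idx x)) :
    tensorPowerAdd (E.fiber y) i j ((tensor (E.tensorPower i) (E.tensorPower j)).frame x y k) =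
      (E.tensorPower (i + j)).frame x y (Fin.appendEquiv i j k) := by
  refine (tensorPowerAdd_tmul _ _).trans ?_
  refine congrArg (PiTensorProduct.tprod ℂ) (funext fun l => ?_)
  refine Fin.addCases (fun l => ?_) (fun l => ?_) l <;> simp [Fin.appendEquiv]

theorem isContHom_tensorPowerAdd (E : VecBundle.{u, v} X) (i j : ℕ) :
    IsContHom (tensor (E.tensorPower i) (E.tensorPower j)) (E.tensorPower (i + j))
      (fun x => (tensorPowerAdd (E.fiber x) i j).toLinearMap) :=
  isContHom_of_frame _ (fun _ => Fin.appendEquiv i j) (fun _ _ hy => hy.1)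
    fun x y _ k => E.tensorPowerAdd_frame i j x y k

theorem isContHom_tensorPowerAdd_symm (E : VecBundle.{u, v} X) (i j : ℕ) :
    IsContHom (E.tensorPower (i + j)) (tensor (E.tensorPower i) (E.tensorPower j))
      (fun x => (tensorPowerAdd (E.fiber x) i j).symm.toLinearMap) := by
  refine isContHom_of_frame _ (fun _ => (Fin.appendEquiv i j).symm) (fun _ _ hy => ⟨hy, hy⟩)
    fun x y _ k => ?_
  refine (LinearEquiv.symm_apply_eq _).2 ?_
  refine Eq.trans ?_ (E.tensorPowerAdd_frame i j x y _).symm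
  exact congrArg _ ((Fin.appendEquiv i j).apply_symm_apply k).symm

theorem tensorPowerAdd_reindex {M : Type*} [AddCommGroup M] [Module ℂ M] (i j : ℕ)
    (σ : Equiv.Perm (Fin i)) (ρ : Equiv.Perm (Fin j)) :
    (tensorPowerAdd M i j).toLinearMap ∘ₗ TensorProduct.map
      (PiTensorProduct.reindex ℂ (fun _ => M) σ).toLinearMap
      (PiTensorProduct.reindex ℂ (fun _ => M) ρ).toLinearMap =
    (PiTensorProduct.reindex ℂ (fun _ => M) (permSum i j (σ, 1))).toLinearMap ∘ₗ
      (PiTensorProduct.reindex ℂ (fun _ => M) (permSum i j (1, ρ))).toLinearMap ∘ₗ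
      (tensorPowerAdd M i j).toLinearMap := by
  refine TensorProduct.ext (PiTensorProduct.ext (MultilinearMap.ext fun a =>
    PiTensorProduct.ext (MultilinearMap.ext fun b => ?_)))
  change tensorPowerAdd M i j (PiTensorProduct.reindex ℂ (fun _ => M) σ (PiTensorProduct.tprod ℂ a)
      ⊗ₜ PiTensorProduct.reindex ℂ (fun _ => M) ρ (PiTensorProduct.tprod ℂ b)) =
    PiTensorProduct.reindex ℂ (fun _ => M) (permSum i j (σ, 1))
      (PiTensorProduct.reindex ℂ (fun _ => M) (permSum i j (1, ρ))
        (tensorPowerAdd M i j (PiTensorProduct.tprod ℂ a ⊗ₜ PiTensorProduct.tprod ℂ b)))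
  rw [PiTensorProduct.reindex_tprod, PiTensorProduct.reindex_tprod, tensorPowerAdd_tmul,
    tensorPowerAdd_tmul, PiTensorProduct.reindex_tprod, PiTensorProduct.reindex_tprod]
  refine congrArg (PiTensorProduct.tprod ℂ) (funext fun l => ?_)
  -- Reindexing uses inverse permutations; moving the inverse inside `permSum` lets both sides be
  -- evaluated on the two blocks.
  simp only [← Equiv.Perm.inv_def, ← map_inv]
  refine Fin.addCases (fun l => ?_) (fun l => ?_) l <;> simp

theorem trace_symTensorPower_mul (E : VecBundle.{u, v} X) (i j : ℕ)
    (a : MonoidAlgebra ℂ (Equiv.Perm (Fin i))) (b : MonoidAlgebra ℂ (Equiv.Perm (Fin j))) :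
    (E.symTensorPower i).trace a * (E.symTensorPower j).trace b =
      (E.symTensorPower (i + j)).trace
        (MonoidAlgebra.mapDomainAlgHom ℂ ℂ ((permSum i j).comp (MonoidHom.inl _ _)) a *
          MonoidAlgebra.mapDomainAlgHom ℂ ℂ ((permSum i j).comp (MonoidHom.inr _ _)) b) := by
  have hm : ∀ (x : X) (σ : Equiv.Perm (Fin i)) (ρ : Equiv.Perm (Fin j))
      (w : (⨂[ℂ] _ : Fin i, E.fiber x) ⊗[ℂ] (⨂[ℂ] _ : Fin j, E.fiber x)),
      tensorPowerAdd (E.fiber x) i j (TensorProduct.map ((E.symTensorPower i).action x σ)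
        ((E.symTensorPower j).action x ρ) w) =
      (E.symTensorPower (i + j)).action x ((permSum i j).comp (MonoidHom.inl _ _) σ)
        ((E.symTensorPower (i + j)).action x ((permSum i j).comp (MonoidHom.inr _ _) ρ)
          (tensorPowerAdd (E.fiber x) i j w)) :=
    fun x σ ρ w => LinearMap.congr_fun (tensorPowerAdd_reindex (M := E.fiber x) i j σ ρ) w
  have hc : ∀ (σ : Equiv.Perm (Fin i)) (ρ : Equiv.Perm (Fin j)),
      Commute ((permSum i j).comp (MonoidHom.inl _ _) σ)
        ((permSum i j).comp (MonoidHom.inr _ _) ρ) :=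
    fun σ ρ => (MonoidHom.commute_inl_inr σ ρ).map (permSum i j)
  exact GVecBundle.trace_mul_trace (E.symTensorPower i) (E.symTensorPower j)
    (E.symTensorPower (i + j)) _ _ hc (fun x => tensorPowerAdd (E.fiber x) i j)
    (E.isContHom_tensorPowerAdd i j) (E.isContHom_tensorPowerAdd_symm i j) hm a b

end VecBundle

end

noncomputable section

/-! ### Antisymmetrizers -/

/-- A permutation with its sign, in the group algebra. -/
def signOf (n : ℕ) : Equiv.Perm (Fin n) →* MonoidAlgebra ℂ (Equiv.Perm (Fin n)) where
  toFun σ := ((Equiv.Perm.sign σ : ℤ) : ℂ) • MonoidAlgebra.of ℂ _ σ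
  map_one' := by simp [MonoidAlgebra.one_def]
  map_mul' σ ρ := by
    rw [map_mul, map_mul, smul_mul_smul_comm, Units.val_mul, Int.cast_mul]

theorem signOf_apply {n : ℕ} (σ : Equiv.Perm (Fin n)) :
    signOf n σ = ((Equiv.Perm.sign σ : ℤ) : ℂ) • MonoidAlgebra.of ℂ _ σ := rfl

theorem permSign_mul_self {n : ℕ} (σ : Equiv.Perm (Fin n)) :
    ((Equiv.Perm.sign σ : ℤ) : ℂ) * ((Equiv.Perm.sign σ : ℤ) : ℂ) = 1 := by
  rw [← Int.cast_mul, ← Units.val_mul, Int.units_mul_self, Units.val_one, Int.cast_one]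

theorem of_eq_smul_signOf {n : ℕ} (σ : Equiv.Perm (Fin n)) :
    MonoidAlgebra.of ℂ _ σ = ((Equiv.Perm.sign σ : ℤ) : ℂ) • signOf n σ := by
  rw [signOf_apply, smul_smul, permSign_mul_self, one_smul]

/-- The permutations of the first `m` points. -/
def permBelow (n m : ℕ) : Subgroup (Equiv.Perm (Fin n)) where
  carrier := {σ | ∀ x : Fin n, m ≤ x → σ x = x}
  one_mem' _ _ := rfl
  mul_mem' {σ ρ} hσ hρ x hx := by rw [Equiv.Perm.mul_apply, hρ x hx, hσ x hx]
  inv_mem' {σ} hσ x hx := by rw [Equiv.Perm.inv_eq_iff_eq, hσ x hx]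

theorem mem_permBelow_self {n : ℕ} (σ : Equiv.Perm (Fin n)) : σ ∈ permBelow n n :=
  fun x hx => absurd x.2 (not_lt.2 hx)

open Classical in
/-- The sum of the permutations of the first `m` points, with their signs. -/
def signSum (n m : ℕ) : MonoidAlgebra ℂ (Equiv.Perm (Fin n)) :=
  ∑ σ with σ ∈ permBelow n m, signOf n σ

theorem signOf_mul_signSum {n m : ℕ} {σ : Equiv.Perm (Fin n)} (hσ : σ ∈ permBelow n m) :
    signOf n σ * signSum n m = signSum n m := by
  classical
  rw [signSum, Finset.mul_sum]
  refine Finset.sum_equiv (Equiv.mulLeft σ) (fun ρ => ?_) fun ρ _ => (map_mul _ _ _).symm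
  simp [Subgroup.mul_mem_cancel_left _ hσ]

theorem signSum_mul_signOf {n m : ℕ} {σ : Equiv.Perm (Fin n)} (hσ : σ ∈ permBelow n m) :
    signSum n m * signOf n σ = signSum n m := by
  classical
  rw [signSum, Finset.sum_mul]
  refine Finset.sum_equiv (Equiv.mulRight σ) (fun ρ => ?_) fun ρ _ => (map_mul _ _ _).symm
  simp [Subgroup.mul_mem_cancel_right _ hσ]

/-- The signed sum absorbs `σ` on the left and `σ⁻¹` on the right, each up to the sign of `σ`, and
the two signs cancel. -/
theorem of_mul_signSum_mul_of_inv {n m : ℕ} {σ : Equiv.Perm (Fin n)} (hσ : σ ∈ permBelow n m) :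
    MonoidAlgebra.of ℂ _ σ * signSum n m * MonoidAlgebra.of ℂ _ σ⁻¹ = signSum n m := by
  rw [of_eq_smul_signOf, of_eq_smul_signOf, smul_mul_assoc, signOf_mul_signSum hσ, mul_smul_comm,
    smul_mul_assoc, signSum_mul_signOf (inv_mem hσ), smul_smul, Equiv.Perm.sign_inv, permSign_mul_self,
    one_smul]

theorem signSum_of_le_one {n m : ℕ} (hm : m ≤ 1) : signSum n m = 1 := by
  classical
  have h : ∀ σ, σ ∈ permBelow n m ↔ σ = 1 := by
    refine fun σ => ⟨fun hσ => ?_, fun hσ => hσ ▸ one_mem _⟩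
    have h1 : ∀ x : Fin n, x.1 ≠ 0 → σ x = x := fun x hx => hσ x (by omega)
    refine Equiv.ext fun x => ?_
    by_cases hx : x.1 = 0
    · by_contra h2
      have h3 : (σ x).1 ≠ 0 := fun h4 => h2 (Fin.ext (by rw [h4, Equiv.Perm.one_apply, hx]))
      exact h2 (σ.injective (h1 _ h3))
    · exact h1 x hx
  simp [signSum, h, Finset.filter_eq']

/-- Coset decomposition: a permutation `σ` of the first `m + 1` points is uniquely `ρ * swap j m`
with `ρ` fixing `m`. Here `j = σ⁻¹ m`, and `j = m` gives the trivial coset. -/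
theorem signSum_succ {n m : ℕ} (hm : m < n) :
    signSum n (m + 1) = signSum n m * ∑ j : Fin n with j ≤ ⟨m, hm⟩,
      signOf n (Equiv.swap j ⟨m, hm⟩) := by
  classical
  rw [signSum, signSum, Finset.sum_mul_sum, ← Finset.sum_product']
  symm
  refine Finset.sum_bij' (fun p _ => p.1 * Equiv.swap p.2 ⟨m, hm⟩)
    (fun σ _ => (σ * Equiv.swap (σ⁻¹ ⟨m, hm⟩) ⟨m, hm⟩, σ⁻¹ ⟨m, hm⟩)) ?_ ?_ ?_ ?_ ?_
  · rintro ⟨σ, j⟩ h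
    simp only [Finset.mem_product, Finset.mem_filter, Finset.mem_univ, true_and] at h ⊢
    intro x hx
    rw [Equiv.Perm.mul_apply, Equiv.swap_apply_of_ne_of_ne]
    · exact h.1 x (by omega)
    · rintro rfl
      have := Fin.le_def.1 h.2
      simp only at this
      omega
    · rintro rfl
      simp at hx
  · intro σ h
    simp only [Finset.mem_product, Finset.mem_filter, Finset.mem_univ, true_and] at h ⊢
    have hσ : σ (σ⁻¹ ⟨m, hm⟩) = ⟨m, hm⟩ := σ.apply_symm_apply _
    have hj : σ⁻¹ ⟨m, hm⟩ ≤ ⟨m, hm⟩ := by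
      -- If `σ⁻¹ m` were larger than `m`, then `σ` would fix it, although `σ` sends it to `m`.
      by_contra! hc
      have h1 := (inv_mem h) _ (Nat.succ_le_of_lt (Fin.lt_def.1 hc))
      have h2 := (h _ (Nat.succ_le_of_lt (Fin.lt_def.1 hc)))
      rw [hσ] at h2
      rw [← h2] at hc
      exact lt_irrefl _ hc
    refine ⟨fun x hx => ?_, hj⟩
    rw [Equiv.Perm.mul_apply]
    rcases eq_or_ne x ⟨m, hm⟩ with rfl | hx'
    · rw [Equiv.swap_apply_right, hσ]
    · have hlt : m < x := lt_of_le_of_ne hx fun h3 => hx' (Fin.ext h3.symm)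
      rw [Equiv.swap_apply_of_ne_of_ne _ hx']
      · exact h x hlt
      · rintro rfl
        exact absurd (Fin.le_def.1 hj) (not_le.2 hlt)
  · rintro ⟨σ, j⟩ h
    simp only [Finset.mem_product, Finset.mem_filter, Finset.mem_univ, true_and] at h
    have h1 : σ⁻¹ ⟨m, hm⟩ = ⟨m, hm⟩ := (inv_mem h.1) _ le_rfl
    simp [mul_inv_rev, Equiv.Perm.mul_apply, h1, mul_assoc]
  · intro σ h
    simp [mul_assoc]
  · rintro ⟨σ, j⟩ h
    exact (map_mul _ _ _).symm

/-- The antisymmetrizer. -/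
def antisymmetrizer (n : ℕ) : MonoidAlgebra ℂ (Equiv.Perm (Fin n)) :=
  ((n.factorial : ℂ))⁻¹ • signSum n n

theorem signSum_self (n : ℕ) : signSum n n = ∑ σ, signOf n σ := by
  classical
  simp [signSum, mem_permBelow_self]

theorem isIdempotentElem_antisymmetrizer (n : ℕ) : IsIdempotentElem (antisymmetrizer n) := by
  have h : signSum n n * signSum n n = (n.factorial : ℂ) • signSum n n := by
    conv_lhs => enter [1]; rw [signSum_self]
    rw [Finset.sum_mul, Finset.sum_congr rfl fun σ _ => signOf_mul_signSum (mem_permBelow_self σ),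
      Finset.sum_const, Finset.card_univ, Fintype.card_perm, Fintype.card_fin, Nat.cast_smul_eq_nsmul]
  have h0 : (n.factorial : ℂ) ≠ 0 := by exact_mod_cast n.factorial_ne_zero
  rw [IsIdempotentElem, antisymmetrizer, smul_mul_smul_comm, h, smul_smul, mul_assoc,
    inv_mul_cancel₀ h0, mul_one]

end

noncomputable section

/-! ### Exterior powers as images of antisymmetrizers -/

namespace VecBundle

variable {X : Type u} [TopologicalSpace X]

/-- Coordinates in an exterior power are minors. The indices `t` do not depend on `y`, so continuity
reduces to that of a determinant. -/
theorem exists_extPower_coord (F : VecBundle.{u, v} X) (k : ℕ) (x' : X)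
    (s : (F.extPower k).idx x') : ∃ t : Fin k → F.idx x', ∀ y (w : Fin k → F.fiber y),
      (F.extPower k).coord x' y s (exteriorPower.ιMulti ℂ k w) =
        (Matrix.of fun i j => F.coord x' y (t j) (w i)).det :=
  ⟨_, fun _ _ => exteriorPower.pairingDual_ιMulti_ιMulti _ _⟩

theorem continuousOn_extPower_coord (F : VecBundle.{u, v} X) (k : ℕ) (x' : X)
    (s : (F.extPower k).idx x') (w : ∀ y, Fin k → F.fiber y) {U : Set X}
    (h : ∀ i l, ContinuousOn (fun y => F.coord x' y i (w y l)) U) :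
    ContinuousOn (fun y => (F.extPower k).coord x' y s (exteriorPower.ιMulti ℂ k (w y))) U := by
  obtain ⟨t, ht⟩ := F.exists_extPower_coord k x' s
  simp only [ht]
  have hM : ContinuousOn (fun y => Matrix.of fun i j => F.coord x' y (t j) (w y i)) U :=
    continuousOn_pi.2 fun i => continuousOn_pi.2 fun j => h (t j) i
  exact continuous_id.matrix_det.comp_continuousOn hM

/-- The positions in the local frame of `E` of the factors of a member of the local frame
of `Λ^k E`. -/
theorem exists_extPower_frame (E : VecBundle.{u, v} X) (k : ℕ) (x : X) (s : (E.extPower k).idx x) :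
    ∃ t : Fin k → E.idx x, ∀ y, (E.extPower k).frame x y s =
      exteriorPower.ιMulti ℂ k (fun l => E.frame x y (t l)) :=
  ⟨_, fun _ => rfl⟩

theorem isContHom_toTensorPower (E : VecBundle.{u, v} X) (k : ℕ) :
    IsContHom (E.extPower k) (E.tensorPower k)
      (fun x => exteriorPower.toTensorPower ℂ (E.fiber x) k) := by
  intro x x' i j
  obtain ⟨t, ht⟩ := E.exists_extPower_frame k x j
  have h : ∀ y, (E.tensorPower k).coord x' y i (exteriorPower.toTensorPower ℂ (E.fiber y) k
      ((E.extPower k).frame x y j)) = ∑ σ : Equiv.Perm (Fin k), Equiv.Perm.sign σ •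
        (E.tensorPower k).coord x' y i ((E.tensorPower k).frame x y (t ∘ σ)) := by
    intro y
    rw [ht]
    refine (congrArg _ (exteriorPower.toTensorPower_apply_ιMulti (R := ℂ) _)).trans ?_
    refine (map_sum _ _ _).trans (Finset.sum_congr rfl fun σ _ => ?_)
    rw [Units.smul_def, Units.smul_def]
    exact map_zsmul _ _ _
  have hc : ContinuousOn (fun y => ∑ σ : Equiv.Perm (Fin k), ((Equiv.Perm.sign σ : ℤ) : ℂ) *
      (E.tensorPower k).coord x' y i ((E.tensorPower k).frame x y (t ∘ σ)))
      (E.dom x ∩ E.dom x') := by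
    refine continuousOn_finsetSum _ fun σ _ => continuousOn_const.mul ?_
    exact ((E.tensorPower k).continuousOn_transition x' x i (t ∘ σ)).mono fun y hy => ⟨hy.2, hy.1⟩
  refine hc.congr fun y _ => (h y).trans (Finset.sum_congr rfl fun σ _ => ?_)
  rw [Units.smul_def, zsmul_eq_mul]

/-- The projection of the tensor power to the exterior power. -/
def tensorPowerToExteriorPower (M : Type*) [AddCommGroup M] [Module ℂ M] (k : ℕ) :
    (⨂[ℂ] _ : Fin k, M) →ₗ[ℂ] ⋀[ℂ]^k M :=
  PiTensorProduct.lift (exteriorPower.ιMulti ℂ k).toMultilinearMap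

theorem tensorPowerToExteriorPower_tprod {M : Type*} [AddCommGroup M] [Module ℂ M] {k : ℕ}
    (w : Fin k → M) : tensorPowerToExteriorPower M k (PiTensorProduct.tprod ℂ w) =
      exteriorPower.ιMulti ℂ k w :=
  PiTensorProduct.lift.tprod _

theorem isContHom_tensorPowerToExteriorPower (E : VecBundle.{u, v} X) (k : ℕ) :
    IsContHom (E.tensorPower k) (E.extPower k)
      (fun x => tensorPowerToExteriorPower (E.fiber x) k) := by
  intro x x' i j
  have h := continuousOn_extPower_coord E k x' i (fun y l => E.frame x y (j l))
    (U := E.dom x ∩ E.dom x') fun i' l =>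
      (E.continuousOn_transition x' x i' (j l)).mono fun y hy => ⟨hy.2, hy.1⟩
  refine h.congr fun y _ => ?_
  exact congrArg _ (tensorPowerToExteriorPower_tprod _)

/-- In each of the `k!` terms the sign of the antisymmetrization cancels the sign from reordering
the wedge product. -/
theorem tensorPowerToExteriorPower_comp_toTensorPower {M : Type*} [AddCommGroup M] [Module ℂ M]
    (k : ℕ) : tensorPowerToExteriorPower M k ∘ₗ exteriorPower.toTensorPower ℂ M k =
      (k.factorial : ℂ) • LinearMap.id := by
  refine exteriorPower.linearMap_ext (AlternatingMap.ext fun w => ?_)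
  simp only [LinearMap.compAlternatingMap_apply, LinearMap.comp_apply,
    exteriorPower.toTensorPower_apply_ιMulti, map_sum, LinearMap.smul_apply, LinearMap.id_apply]
  have h : ∀ σ : Equiv.Perm (Fin k), tensorPowerToExteriorPower M k
      (Equiv.Perm.sign σ • PiTensorProduct.tprod ℂ fun i => w (σ i)) =
        exteriorPower.ιMulti ℂ k w := by
    intro σ
    rw [Units.smul_def, map_zsmul, tensorPowerToExteriorPower_tprod, ← Units.smul_def]
    have h1 := (exteriorPower.ιMulti ℂ k).map_perm w σ
    refine (congrArg _ h1).trans ?_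
    rw [smul_smul, Int.units_mul_self, one_smul]
  rw [Finset.sum_congr rfl fun σ _ => h σ, Finset.sum_const, Finset.card_univ, Fintype.card_perm,
    Fintype.card_fin, Nat.cast_smul_eq_nsmul]

theorem toTensorPower_comp_tensorPowerToExteriorPower (E : VecBundle.{u, v} X) (k : ℕ) (x : X) :
    exteriorPower.toTensorPower ℂ (E.fiber x) k ∘ₗ tensorPowerToExteriorPower (E.fiber x) k =
      (E.symTensorPower k).algAction x (signSum k k) := by
  rw [signSum_self, map_sum]
  refine PiTensorProduct.ext (MultilinearMap.ext fun w => ?_)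
  have h1 : exteriorPower.toTensorPower ℂ (E.fiber x) k (tensorPowerToExteriorPower (E.fiber x) k
      (PiTensorProduct.tprod ℂ w)) = ∑ σ : Equiv.Perm (Fin k), Equiv.Perm.sign σ •
        PiTensorProduct.tprod ℂ (fun i => w (σ i)) := by
    rw [tensorPowerToExteriorPower_tprod, exteriorPower.toTensorPower_apply_ιMulti]
  have h2 : ∀ σ : Equiv.Perm (Fin k), (E.symTensorPower k).algAction x (signOf k σ)
      (PiTensorProduct.tprod ℂ w) =
        ((Equiv.Perm.sign σ : ℤ) : ℂ) • PiTensorProduct.tprod ℂ (fun i => w (σ⁻¹ i)) := by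
    intro σ
    rw [signOf_apply, map_smul, GVecBundle.algAction_of]
    exact congrArg (((Equiv.Perm.sign σ : ℤ) : ℂ) • ·) (PiTensorProduct.reindex_tprod (R := ℂ) σ w)
  refine h1.trans (Eq.trans ?_ (LinearMap.sum_apply _ _ _).symm)
  refine Eq.trans ?_ (Finset.sum_congr rfl fun σ _ => h2 σ).symm
  -- The action places factors by `σ⁻¹`, the antisymmetrization by `σ`; inversion matches the terms
  -- and preserves signs.
  refine Finset.sum_equiv (Equiv.inv _) (by simp) fun σ _ => ?_
  rw [Equiv.inv_apply, inv_inv, Equiv.Perm.sign_inv, Units.smul_def, Int.cast_smul_eq_zsmul]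

theorem isImage_extPower (E : VecBundle.{u, v} X) (k : ℕ) :
    IsImage (E.extPower k) (E.tensorPower k)
      (fun x => (E.symTensorPower k).algAction x (antisymmetrizer k)) := by
  have h0 : (k.factorial : ℂ) ≠ 0 := by exact_mod_cast k.factorial_ne_zero
  -- The two unnormalized maps compose to `k!` on `Λ^k` and to `signSum k k` on the tensor power.
  -- Dividing one of them by `k!` gives the identity and the antisymmetrizer.
  refine ⟨_, _, (E.isContHom_toTensorPower k).smul (k.factorial : ℂ)⁻¹,
    E.isContHom_tensorPowerToExteriorPower k, fun x => ?_, fun x => ?_⟩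
  · have h1 : tensorPowerToExteriorPower (E.fiber x) k ∘ₗ
        ((k.factorial : ℂ)⁻¹ • exteriorPower.toTensorPower ℂ (E.fiber x) k) = LinearMap.id := by
      rw [LinearMap.comp_smul, tensorPowerToExteriorPower_comp_toTensorPower, smul_smul,
        inv_mul_cancel₀ h0, one_smul]
    exact h1
  · have h1 : ((k.factorial : ℂ)⁻¹ • exteriorPower.toTensorPower ℂ (E.fiber x) k) ∘ₗ
        tensorPowerToExteriorPower (E.fiber x) k =
          (k.factorial : ℂ)⁻¹ • (E.symTensorPower k).algAction x (signSum k k) := by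
      rw [LinearMap.smul_comp, toTensorPower_comp_tensorPowerToExteriorPower]
      rfl
    exact h1.trans (map_smul _ _ _).symm

theorem trace_antisymmetrizer (E : VecBundle.{u, v} X) (k : ℕ) :
    (E.symTensorPower k).trace (antisymmetrizer k) = 1 ⊗ₜ (E.extPower k).kclass :=
  (E.symTensorPower k).trace_of_isImage (isIdempotentElem_antisymmetrizer k) (E.isImage_extPower k)

end VecBundle

end

noncomputable section

/-! ### Exterior powers of direct sums with a line bundle -/

namespace VecBundle

variable {X : Type u} [TopologicalSpace X]

theorem finite_fiber (E : VecBundle.{u, v} X) (x : X) : Module.Finite ℂ (E.fiber x) :=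
  Module.Finite.of_basis (E.basis x x (E.mem_dom x))

/-- A continuous family of bijective linear maps is an isomorphism. -/
theorem isIso_of_bijective {E F : VecBundle.{u, v} X} {f : ∀ x, E.fiber x →ₗ[ℂ] F.fiber x}
    (hf : IsContHom E F f) (hb : ∀ x, Function.Bijective (f x)) : IsIso E F := by
  refine ⟨fun x => LinearEquiv.ofBijective (f x) (hb x), hf, ?_⟩
  intro x x' i j
  rcases (F.dom x ∩ E.dom x').eq_empty_or_nonempty with h0 | ⟨y₀, hy₀⟩
  · rw [h0]
    exact continuousOn_empty _
  -- The two frames have equally many members, as seen over one common point `y₀`. Identifying the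
  -- index sets makes the matrices of the maps square, so that determinants are available.
  let e : E.idx x' ≃ F.idx x :=
    ((E.basis x' y₀ hy₀.2).map (LinearEquiv.ofBijective (f y₀) (hb y₀))).indexEquiv
      (F.basis x y₀ hy₀.1)
  let M : X → Matrix (E.idx x') (E.idx x') ℂ := fun y =>
    Matrix.of fun a b => F.coord x y (e a) (f y (E.frame x' y b))
  let N : X → Matrix (E.idx x') (E.idx x') ℂ := fun y =>
    Matrix.of fun a b => E.coord x' y a
      ((LinearEquiv.ofBijective (f y) (hb y)).symm (F.frame x y (e b)))
  have hNM : ∀ y ∈ F.dom x ∩ E.dom x', N y * M y = 1 := by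
    intro y hy
    refine Matrix.ext fun a b => ?_
    rw [Matrix.mul_apply, Matrix.one_apply, ← E.coord_frame x' y hy.2 a b]
    refine (
      Equiv.sum_comp e (fun c => E.coord x' y a
        ((LinearEquiv.ofBijective (f y) (hb y)).symm (F.frame x y c)) *
          F.coord x y c (f y (E.frame x' y b)))).trans ?_
    have h1 := F.sum_coord_smul_frame x y hy.1 (f y (E.frame x' y b))
    have h2 : (LinearEquiv.ofBijective (f y) (hb y)).symm (f y (E.frame x' y b)) =
        E.frame x' y b := (LinearEquiv.ofBijective (f y) (hb y)).symm_apply_apply _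
    conv_rhs => rw [← h2, ← h1, map_sum, map_sum]
    refine Finset.sum_congr rfl fun c _ => ?_
    rw [map_smul, map_smul, smul_eq_mul, mul_comm]
  have hM : ContinuousOn M (F.dom x ∩ E.dom x') :=
    continuousOn_pi.2 fun a => continuousOn_pi.2 fun b =>
      (hf x' x (e a) b).mono fun y hy => ⟨hy.2, hy.1⟩
  have hdet : ∀ y ∈ F.dom x ∩ E.dom x', (M y).det ≠ 0 := by
    intro y hy h0
    have h1 := congrArg Matrix.det (hNM y hy)
    rw [Matrix.det_mul, h0, mul_zero, Matrix.det_one] at h1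
    exact zero_ne_one h1
  have hI : ContinuousOn (fun y => (M y)⁻¹) (F.dom x ∩ E.dom x') := by
    simp only [Matrix.inv_def, Ring.inverse_eq_inv']
    exact ((continuous_id.matrix_det.comp_continuousOn hM).inv₀ hdet).smul
      (continuous_id.matrix_adjugate.comp_continuousOn hM)
  refine (continuousOn_pi.1 (continuousOn_pi.1 hI i) (e.symm j)).congr fun y hy => ?_
  have h1 : (M y)⁻¹ i (e.symm j) = N y i (e.symm j) := by rw [Matrix.inv_eq_left_inv (hNM y hy)]
  have h2 : N y i (e.symm j) = E.coord x' y i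
      ((LinearEquiv.ofBijective (f y) (hb y)).symm (F.frame x y j)) := by
    simp only [N, Matrix.of_apply, Equiv.apply_symm_apply]
  exact (h1.trans h2).symm

/-! ### Functoriality and degree zero of exterior powers -/

theorem isContHom_extPower_map {E F : VecBundle.{u, v} X} {f : ∀ x, E.fiber x →ₗ[ℂ] F.fiber x}
    (hf : IsContHom E F f) (k : ℕ) :
    IsContHom (E.extPower k) (F.extPower k) (fun x => exteriorPower.map k (f x)) := by
  intro x x' i j
  obtain ⟨t, ht⟩ := E.exists_extPower_frame k x j
  have h := continuousOn_extPower_coord F k x' i (fun y l => f y (E.frame x y (t l)))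
    (U := E.dom x ∩ F.dom x') fun i' l => hf x x' i' (t l)
  refine h.congr fun y _ => ?_
  rw [ht]
  exact congrArg _ (exteriorPower.map_apply_ιMulti _ _)

theorem isIso_extPower_congr {E F : VecBundle.{u, v} X} (h : IsIso E F) (k : ℕ) :
    IsIso (E.extPower k) (F.extPower k) := by
  obtain ⟨f, hf, hf'⟩ := h
  refine isIso_of_inverse (isContHom_extPower_map hf k) (isContHom_extPower_map hf' k)
    (fun x => ?_) fun x => ?_
  · refine (exteriorPower.map_comp (f x).symm.toLinearMap (f x).toLinearMap).symm.trans ?_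
    rw [LinearEquiv.comp_symm]
    exact exteriorPower.map_id
  · refine (exteriorPower.map_comp (f x).toLinearMap (f x).symm.toLinearMap).symm.trans ?_
    rw [LinearEquiv.symm_comp]
    exact exteriorPower.map_id

theorem isIso_extPower_zero (E : VecBundle.{u, v} X) : IsIso (E.extPower 0) (one X) := by
  refine ⟨fun x => (exteriorPower.zeroEquiv ℂ (E.fiber x)).trans ULift.moduleEquiv.symm, ?_, ?_⟩
  · intro x x' i j
    obtain ⟨t, ht⟩ := E.exists_extPower_frame 0 x j
    refine (continuousOn_const (c := (1 : ℂ))).congr fun y _ => ?_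
    rw [ht]
    exact exteriorPower.zeroEquiv_ιMulti (R := ℂ) (M := E.fiber y) _
  · intro x x' i j
    have h := continuousOn_extPower_coord E 0 x' i (fun y l => l.elim0)
      (U := Set.univ ∩ E.dom x') fun i' l => l.elim0
    refine h.congr fun y _ => congrArg _ ?_
    refine (LinearEquiv.symm_apply_eq _).2 ?_
    refine ULift.ext _ _ ?_
    exact (exteriorPower.zeroEquiv_ιMulti (R := ℂ) (M := E.fiber y) _).symm

theorem kclass_extPower_zero (E : VecBundle.{u, v} X) : (E.extPower 0).kclass = 1 :=
  E.isIso_extPower_zero.kclass_eq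

end VecBundle

/-- The exterior product with a vector. -/
def wedgeVector (M : Type*) [AddCommGroup M] [Module ℂ M] (k : ℕ) :
    (⋀[ℂ]^k M) ⊗[ℂ] M →ₗ[ℂ] ⋀[ℂ]^(k + 1) M :=
  TensorProduct.lift (LinearMap.mk₂ ℂ
    (fun ω w => ⟨ω.1 * ExteriorAlgebra.ι ℂ w, by
      have h := Submodule.mul_mem_mul ω.2 (LinearMap.mem_range_self (ExteriorAlgebra.ι ℂ) w)
      rwa [← pow_succ] at h⟩)
    (fun a b w => Subtype.ext (add_mul _ _ _))
    (fun c a w => Subtype.ext (smul_mul_assoc _ _ _))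
    (fun a w w' => Subtype.ext (by simp [mul_add]))
    (fun c a w => Subtype.ext (by simp)))

theorem wedgeVector_ιMulti {M : Type*} [AddCommGroup M] [Module ℂ M] {k : ℕ} (a : Fin k → M)
    (w : M) : wedgeVector M k (exteriorPower.ιMulti ℂ k a ⊗ₜ w) =
      exteriorPower.ιMulti ℂ (k + 1) (Fin.snoc a w : Fin (k + 1) → M) := by
  refine Subtype.ext ?_
  change ExteriorAlgebra.ιMulti ℂ k a * ExteriorAlgebra.ι ℂ w =
    ExteriorAlgebra.ιMulti ℂ (k + 1) (Fin.snoc a w : Fin (k + 1) → M)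
  rw [ExteriorAlgebra.ιMulti_apply, ExteriorAlgebra.ιMulti_apply, List.ofFn_succ_last]
  simp

/-- The map `Λ^{k+1} M ⊕ Λ^k M ⊗ L → Λ^{k+1} (M ⊕ L)`. -/
def extPowerProd (M L : Type*) [AddCommGroup M] [Module ℂ M] [AddCommGroup L] [Module ℂ L]
    (k : ℕ) : (⋀[ℂ]^(k + 1) M) × ((⋀[ℂ]^k M) ⊗[ℂ] L) →ₗ[ℂ] ⋀[ℂ]^(k + 1) (M × L) :=
  (exteriorPower.map (k + 1) (LinearMap.inl ℂ M L)).coprod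
    (wedgeVector (M × L) k ∘ₗ
      TensorProduct.map (exteriorPower.map k (LinearMap.inl ℂ M L)) (LinearMap.inr ℂ M L))

/-- Take a basis of `M` followed by a generator of `L`. In an increasing sequence of `k + 1` basis
vectors only the last one can be that generator. If it is, the wedge comes from `Λ^k M ⊗ L`, and
otherwise from `Λ^{k+1} M`. -/
theorem extPowerProd_surjective {M L : Type*} [AddCommGroup M] [Module ℂ M] [AddCommGroup L]
    [Module ℂ L] [Module.Finite ℂ M] (hL : Module.finrank ℂ L = 1) (k : ℕ) :
    Function.Surjective (extPowerProd M L k) := by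
  obtain ⟨l, hl0, hl⟩ := finrank_eq_one_iff'.1 hL
  set d := Module.finrank ℂ M
  let b : Module.Basis (Fin d) ℂ M := Module.finBasis ℂ M
  let w : Fin (d + 1) → M × L := Fin.snoc (fun i => LinearMap.inl ℂ M L (b i)) (LinearMap.inr ℂ M L l)
  have hw : ∀ i, w (Fin.castSucc i) = LinearMap.inl ℂ M L (b i) := fun i => by simp [w]
  have hw' : w (Fin.last d) = LinearMap.inr ℂ M L l := by simp [w]
  have hspan : Submodule.span ℂ (Set.range w) = ⊤ := by
    rw [eq_top_iff]
    rintro ⟨m, z⟩ -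
    have h1 : ∀ m : M, LinearMap.inl ℂ M L m ∈ Submodule.span ℂ (Set.range w) := by
      intro m
      rw [← b.sum_repr m, map_sum]
      refine Submodule.sum_mem _ fun i _ => ?_
      rw [map_smul, ← hw]
      exact Submodule.smul_mem _ _ (Submodule.subset_span ⟨_, rfl⟩)
    obtain ⟨c, rfl⟩ := hl z
    have h2 : ((m, c • l) : M × L) = LinearMap.inl ℂ M L m + c • w (Fin.last d) := by
      rw [hw']
      simp
    rw [h2]
    exact Submodule.add_mem _ (h1 m) (Submodule.smul_mem _ _ (Submodule.subset_span ⟨_, rfl⟩))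
  rw [← LinearMap.range_eq_top, eq_top_iff,
    ← exteriorPower.ιMulti_family_span_of_span ℂ (n := k + 1) hspan, Submodule.span_le]
  rintro _ ⟨s, rfl⟩
  obtain ⟨t, ht, hs⟩ : ∃ t : Fin (k + 1) → Fin (d + 1), StrictMono t ∧
      exteriorPower.ιMulti_family ℂ (k + 1) w s = exteriorPower.ιMulti ℂ (k + 1) (w ∘ t) :=
    ⟨_, OrderEmbedding.strictMono _, rfl⟩
  rw [hs]
  have hlt : ∀ i : Fin k, t (Fin.castSucc i) < Fin.last d := fun i =>
    (ht (Fin.castSucc_lt_last i)).trans_le (Fin.le_last _)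
  by_cases hlast : t (Fin.last k) = Fin.last d
  · refine ⟨(0, exteriorPower.ιMulti ℂ k (fun i => b ((t (Fin.castSucc i)).castPred (hlt i).ne))
      ⊗ₜ l), ?_⟩
    simp only [extPowerProd, LinearMap.coprod_apply, map_zero, zero_add, LinearMap.comp_apply,
      TensorProduct.map_tmul, exteriorPower.map_apply_ιMulti, wedgeVector_ιMulti]
    congr 1
    funext i
    refine Fin.lastCases ?_ (fun i => ?_) i
    · rw [Fin.snoc_last, Function.comp_apply, hlast, hw']
    · rw [Fin.snoc_castSucc, Function.comp_apply, Function.comp_apply, ← hw, Fin.castSucc_castPred]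
  · have hne : ∀ i, t i ≠ Fin.last d := by
      intro i
      refine Fin.lastCases hlast (fun i => (hlt i).ne) i
    refine ⟨(exteriorPower.ιMulti ℂ (k + 1) (fun i => b ((t i).castPred (hne i))), 0), ?_⟩
    simp only [extPowerProd, LinearMap.coprod_apply, map_zero, add_zero,
      exteriorPower.map_apply_ιMulti]
    congr 1
    funext i
    rw [Function.comp_apply, Function.comp_apply, ← hw, Fin.castSucc_castPred]

theorem bijective_of_surjective_of_finrank_eq {V W : Type*} [AddCommGroup V] [Module ℂ V]
    [AddCommGroup W] [Module ℂ W] [Module.Finite ℂ V] [Module.Finite ℂ W] (f : V →ₗ[ℂ] W)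
    (hd : Module.finrank ℂ V = Module.finrank ℂ W) (hf : Function.Surjective f) :
    Function.Bijective f :=
  ⟨(LinearMap.injective_iff_surjective_of_finrank_eq_finrank hd).2 hf, hf⟩

/-- By Pascal's rule the two sides have equal dimension, so surjectivity suffices. -/
theorem extPowerProd_bijective {M L : Type*} [AddCommGroup M] [Module ℂ M] [AddCommGroup L]
    [Module ℂ L] [Module.Finite ℂ M] (hL : Module.finrank ℂ L = 1) (k : ℕ) :
    Function.Bijective (extPowerProd M L k) := by
  have : Module.Finite ℂ L := Module.finite_of_finrank_eq_succ hL
  have hs := extPowerProd_surjective (M := M) hL k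
  have hd : Module.finrank ℂ ((⋀[ℂ]^(k + 1) M) × ((⋀[ℂ]^k M) ⊗[ℂ] L)) =
      Module.finrank ℂ (⋀[ℂ]^(k + 1) (M × L)) := by
    rw [Module.finrank_prod, Module.finrank_tensorProduct, exteriorPower.finrank_eq,
      exteriorPower.finrank_eq, exteriorPower.finrank_eq, Module.finrank_prod, hL, mul_one,
      Nat.choose_succ_succ, add_comm]
  exact bijective_of_surjective_of_finrank_eq (V := (⋀[ℂ]^(k + 1) M) × ((⋀[ℂ]^k M) ⊗[ℂ] L))
    (W := ⋀[ℂ]^(k + 1) (M × L)) (extPowerProd M L k) hd hs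

namespace VecBundle

variable {X : Type u} [TopologicalSpace X]

theorem isContHom_wedgeVector (F : VecBundle.{u, v} X) (k : ℕ) :
    IsContHom (tensor (F.extPower k) F) (F.extPower (k + 1))
      (fun x => wedgeVector (F.fiber x) k) := by
  intro x x' i j
  obtain ⟨t, ht⟩ := F.exists_extPower_frame k x j.1
  have h := continuousOn_extPower_coord F (k + 1) x' i
    (fun y => (Fin.snoc (fun l => F.frame x y (t l)) (F.frame x y j.2) : Fin (k + 1) → F.fiber y))
    (U := (F.dom x ∩ F.dom x) ∩ F.dom x') (fun i' l => by
      have hc : ∀ j, ContinuousOn (fun y => F.coord x' y i' (F.frame x y j))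
          ((F.dom x ∩ F.dom x) ∩ F.dom x') := fun j =>
        (F.continuousOn_transition x' x i' j).mono fun y hy => ⟨hy.2, hy.1.1⟩
      refine Fin.lastCases ?_ (fun l => ?_) l
      · simpa only [Fin.snoc_last] using hc j.2
      · simpa only [Fin.snoc_castSucc] using hc (t l))
  refine h.congr fun y _ => congrArg _ ?_
  have h1 : (tensor (F.extPower k) F).frame x y j =
      (exteriorPower.ιMulti ℂ k (fun l => F.frame x y (t l)) ⊗ₜ F.frame x y j.2 :
        (⋀[ℂ]^k (F.fiber y)) ⊗[ℂ] F.fiber y) := congrArg (· ⊗ₜ F.frame x y j.2) (ht y)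
  exact (congrArg _ h1).trans (wedgeVector_ιMulti _ _)

/-- The fibrewise map is continuous and bijective; continuity of its inverse is then automatic. -/
theorem isIso_extPower_directSum (E L : VecBundle.{u, v} X) (hL : L.IsLineBundle) (k : ℕ) :
    IsIso (directSum (E.extPower (k + 1)) (tensor (E.extPower k) L))
      ((directSum E L).extPower (k + 1)) := by
  have hc : IsContHom (directSum (E.extPower (k + 1)) (tensor (E.extPower k) L))
      ((directSum E L).extPower (k + 1)) (fun x => extPowerProd (E.fiber x) (L.fiber x) k) :=
    isContHom_coprod (isContHom_extPower_map (isContHom_inl E L) (k + 1))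
      ((isContHom_wedgeVector (directSum E L) k).comp
        (isContHom_tensor_map (isContHom_extPower_map (isContHom_inl E L) k) (isContHom_inr E L)))
  refine isIso_of_bijective hc fun x => ?_
  have := E.finite_fiber x
  exact extPowerProd_bijective (hL x) k

theorem kclass_extPower_directSum (E L : VecBundle.{u, v} X) (hL : L.IsLineBundle) (k : ℕ) :
    ((directSum E L).extPower (k + 1)).kclass =
      (E.extPower (k + 1)).kclass + (E.extPower k).kclass * L.kclass := by
  rw [← (isIso_extPower_directSum E L hL k).kclass_eq, kclass_directSum, kclass_tensor]

end VecBundle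

end

noncomputable section

/-! ### Newton's identities for traces of cycles -/

theorem mapDomainAlgHom_of {G H : Type*} [Group G] [Group H] (φ : G →* H) (g : G) :
    MonoidAlgebra.mapDomainAlgHom ℂ ℂ φ (MonoidAlgebra.of ℂ G g) = MonoidAlgebra.of ℂ H (φ g) := by
  simp [MonoidAlgebra.of_apply, MonoidAlgebra.mapDomainAlgHom_apply, MonoidAlgebra.mapDomain_single]

/-! ### Block permutations and overlapping cycles -/

theorem sign_permSum (i j : ℕ) (σ : Equiv.Perm (Fin i)) (ρ : Equiv.Perm (Fin j)) :
    Equiv.Perm.sign (permSum i j (σ, ρ)) = Equiv.Perm.sign σ * Equiv.Perm.sign ρ := by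
  rw [← Equiv.Perm.sign_sumCongr]
  exact Equiv.Perm.sign_permCongr _ _

theorem permSum_inl_injective (i j : ℕ) :
    Function.Injective (fun σ : Equiv.Perm (Fin i) => permSum i j (σ, 1)) := by
  intro σ ρ h
  refine Equiv.ext fun x => ?_
  have h1 := Equiv.congr_fun h (Fin.castAdd j x)
  simpa using h1

theorem mem_permBelow_add {i j : ℕ} {ρ : Equiv.Perm (Fin (i + j))} :
    ρ ∈ permBelow (i + j) i ↔ ∃ σ : Equiv.Perm (Fin i), permSum i j (σ, 1) = ρ := by
  constructor
  · intro h
    -- A point sent to some `y ≥ i` would have the same image as `y`, which is fixed.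
    have h1 : ∀ ρ ∈ permBelow (i + j) i, ∀ x : Fin i, (ρ (Fin.castAdd j x)).1 < i := by
      intro ρ h x
      by_contra! hx
      have h2 := ρ.injective (h _ hx)
      have h3 : (ρ (Fin.castAdd j x)).1 = x.1 := congrArg Fin.val h2
      omega
    refine ⟨⟨fun x => ⟨_, h1 ρ h x⟩, fun x => ⟨_, h1 ρ⁻¹ (inv_mem h) x⟩, fun x => ?_,
      fun x => ?_⟩, ?_⟩
    · refine Fin.ext ?_
      change (ρ.symm (ρ (Fin.castAdd j x))).1 = x.1
      rw [ρ.symm_apply_apply, Fin.val_castAdd]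
    · refine Fin.ext ?_
      change (ρ (ρ.symm (Fin.castAdd j x))).1 = x.1
      rw [ρ.apply_symm_apply, Fin.val_castAdd]
    · refine Equiv.ext fun x => ?_
      refine Fin.addCases (fun x => ?_) (fun x => ?_) x
      · rw [permSum_castAdd]
        rfl
      · rw [permSum_natAdd, h _ (by simp)]
        rfl
  · rintro ⟨σ, rfl⟩ x
    refine Fin.addCases (fun x => ?_) (fun x => ?_) x
    · intro hx
      have := x.2
      simp only [Fin.val_castAdd] at hx
      omega
    · intro _
      simp

theorem mapDomain_signSum (i j : ℕ) :
    MonoidAlgebra.mapDomainAlgHom ℂ ℂ ((permSum i j).comp (MonoidHom.inl _ _)) (signSum i i) =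
      signSum (i + j) i := by
  classical
  rw [signSum_self, map_sum, signSum]
  refine Finset.sum_bij (fun σ _ => permSum i j (σ, 1)) (fun σ _ => ?_)
    (fun σ _ ρ _ h => permSum_inl_injective i j h) (fun ρ hρ => ?_) fun σ _ => ?_
  · exact Finset.mem_filter.2 ⟨Finset.mem_univ _, mem_permBelow_add.2 ⟨σ, rfl⟩⟩
  · obtain ⟨σ, hσ⟩ := mem_permBelow_add.1 (Finset.mem_filter.1 hρ).2
    exact ⟨σ, Finset.mem_univ _, hσ⟩
  · rw [signOf_apply, signOf_apply, map_smul, mapDomainAlgHom_of, sign_permSum, map_one, mul_one]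
    rfl

/-- Identifies the rotation of the second block with the cycle `c_i` of the recursion, so that
multiplicativity applies to it. -/
theorem permSum_finRotate (i j : ℕ) (h : i < i + (j + 1)) :
    permSum i (j + 1) (1, finRotate (j + 1)) = Fin.cycleIcc ⟨i, h⟩ (Fin.last (i + j)) := by
  refine Equiv.ext fun x => ?_
  refine Fin.addCases (fun x => ?_) (fun x => ?_) x
  · rw [permSum_castAdd, Fin.cycleIcc_of_lt]
    · rfl
    · exact Fin.lt_def.2 x.2
  · have h0 := Fin.cycleIcc_of_le_of_le (n := i + j + 1) (i := ⟨i, h⟩) (j := Fin.last (i + j))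
      (k := Fin.natAdd i x) (Fin.le_def.2 (by simp)) (Fin.le_last _)
    refine (permSum_natAdd _ _).trans (Eq.trans ?_ h0.symm)
    split_ifs with hx
    · have hx' : x = Fin.last j := by
        refine Fin.ext ?_
        have := congrArg Fin.val hx
        simp at this
        simpa using this
      subst hx'
      rw [finRotate_last]
      rfl
    · have hx' : x ≠ Fin.last j := by
        rintro rfl
        exact hx rfl
      refine Fin.ext ?_
      have h1 := coe_finRotate_of_ne_last hx'
      have h2 := Fin.val_add_one_of_lt (lt_of_le_of_ne (Fin.le_last _) hx)
      refine Eq.trans ?_ h2.symm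
      change i + (finRotate (j + 1) x).1 = i + x.1 + 1
      rw [h1, add_assoc]

theorem swap_mul_cycleIcc {N i : ℕ} (hi : i + 1 < N + 1) :
    Equiv.swap ⟨i, by omega⟩ ⟨i + 1, hi⟩ * Fin.cycleIcc ⟨i + 1, hi⟩ (Fin.last N) =
      Fin.cycleIcc ⟨i, by omega⟩ (Fin.last N) := by
  -- The transposition is itself an interval cycle, and interval cycles that share an endpoint
  -- concatenate.
  have h1 : Equiv.swap ⟨i, by omega⟩ ⟨i + 1, hi⟩ =
      Fin.cycleIcc (⟨i, by omega⟩ : Fin (N + 1)) ⟨i + 1, hi⟩ := by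
    refine Equiv.ext fun x => ?_
    rcases lt_trichotomy x.1 i with hx | hx | hx
    · rw [Fin.cycleIcc_of_lt (Fin.lt_def.2 hx), Equiv.swap_apply_of_ne_of_ne] <;>
        exact fun h => by simp [h] at hx
    · have hx' : x = ⟨i, by omega⟩ := Fin.ext hx
      rw [hx', Fin.cycleIcc_of_ge_of_lt le_rfl (Fin.lt_def.2 (Nat.lt_succ_self i)),
        Equiv.swap_apply_left]
      refine Fin.ext ?_
      rw [Fin.val_add_one_of_lt (Fin.lt_def.2 (by simp; omega))]
    · rcases (Nat.succ_le_of_lt hx).eq_or_lt with hx' | hx'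
      · have hx'' : x = ⟨i + 1, hi⟩ := Fin.ext hx'.symm
        rw [hx'', Fin.cycleIcc_of_last (Fin.le_def.2 (Nat.le_succ i)), Equiv.swap_apply_right]
      · rw [Fin.cycleIcc_of_gt (Fin.lt_def.2 hx'), Equiv.swap_apply_of_ne_of_ne] <;>
          exact fun h => by simp [h] at hx'
  rw [h1]
  refine Equiv.ext fun x => ?_
  exact congrFun (Fin.cycleIcc.trans (Fin.le_def.2 (Nat.le_succ i)) (Fin.le_last _)) x

/-- The recursion for the traces of products of antisymmetrizers and overlapping cycles. -/
theorem trace_signSum_succ_mul_cycleIcc {N : ℕ} {M : Type*} [AddCommGroup M] [Module ℂ M]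
    (τ : MonoidAlgebra ℂ (Equiv.Perm (Fin (N + 1))) →ₗ[ℂ] M) (hτ : ∀ a b, τ (a * b) = τ (b * a))
    {i : ℕ} (hi : i + 1 < N + 1) :
    τ (signSum (N + 1) (i + 2) * MonoidAlgebra.of ℂ _ (Fin.cycleIcc ⟨i + 1, hi⟩ (Fin.last N))) =
      τ (signSum (N + 1) (i + 1) * MonoidAlgebra.of ℂ _ (Fin.cycleIcc ⟨i + 1, hi⟩ (Fin.last N))) -
        ((i + 1 : ℕ) : ℂ) • τ (signSum (N + 1) (i + 1) *
          MonoidAlgebra.of ℂ _ (Fin.cycleIcc ⟨i, by omega⟩ (Fin.last N))) := by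
  classical
  set m : Fin (N + 1) := ⟨i + 1, hi⟩ with hm
  set l : Fin (N + 1) := ⟨i, by omega⟩ with hl
  set A := signSum (N + 1) (i + 1)
  have hlm : l < m := Fin.lt_def.2 (Nat.lt_succ_self i)
  -- With `c_i` the cycle from `i` to `N`, the product `(j m) c_m` is the conjugate of `c_l` by `(j
  -- l)`. This transposition permutes the first `i + 1` points, so conjugation by it fixes `A`, and
  -- the trace does not see it. The minus sign is that of the transposition `(j m)`.
  have key : ∀ j : Fin (N + 1), j < m →
      τ (A * signOf _ (Equiv.swap j m) * MonoidAlgebra.of ℂ _ (Fin.cycleIcc m (Fin.last N))) =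
        - τ (A * MonoidAlgebra.of ℂ _ (Fin.cycleIcc l (Fin.last N))) := by
    intro j hj
    have hg : Equiv.swap j l ∈ permBelow (N + 1) (i + 1) := by
      intro x hx
      have h1 := Fin.lt_def.1 hj
      simp only [hm] at h1
      refine Equiv.swap_apply_of_ne_of_ne ?_ ?_
      · rintro rfl
        omega
      · rintro rfl
        simp only [hl] at hx
        omega
    -- Both `j` and `l` lie below `m`, outside the support of the cycle.
    have hC : Equiv.swap j l * Fin.cycleIcc m (Fin.last N) =
        Fin.cycleIcc m (Fin.last N) * Equiv.swap j l := by
      rw [Equiv.mul_swap_eq_swap_mul, Fin.cycleIcc_of_lt hj, Fin.cycleIcc_of_lt hlm]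
    have hsw : Equiv.swap j m = Equiv.swap j l * Equiv.swap l m * Equiv.swap j l := by
      rcases eq_or_ne j l with rfl | hjl
      · rw [Equiv.swap_self]
        rfl
      · rw [Equiv.swap_comm j l, Equiv.swap_comm l m]
        exact (Equiv.swap_mul_swap_mul_swap hlm.ne' hj.ne').symm
    have hs : Equiv.swap j m * Fin.cycleIcc m (Fin.last N) =
        (Equiv.swap j l) * Fin.cycleIcc l (Fin.last N) * (Equiv.swap j l)⁻¹ := by
      rw [← swap_mul_cycleIcc hi, Equiv.swap_inv, hsw, mul_assoc, mul_assoc, hC]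
      simp only [mul_assoc]
      rfl
    rw [signOf_apply, Equiv.Perm.sign_swap hj.ne, Units.val_neg, Units.val_one, Int.cast_neg,
      Int.cast_one, neg_smul, one_smul, mul_neg, neg_mul, map_neg, mul_assoc,
      ← map_mul (MonoidAlgebra.of ℂ _), hs, map_mul (MonoidAlgebra.of ℂ _),
      map_mul (MonoidAlgebra.of ℂ _), ← mul_assoc, hτ, ← mul_assoc, ← mul_assoc]
    have h2 := of_mul_signSum_mul_of_inv (inv_mem hg)
    rw [inv_inv] at h2
    rw [h2]
  rw [signSum_succ hi, mul_assoc, Finset.sum_mul, Finset.mul_sum, map_sum]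
  -- The coset of `j = m` gives the first term; the `i + 1` cosets with `j < m` all contribute the
  -- same value.
  have hfilter : Finset.univ.filter (fun j : Fin (N + 1) => j ≤ m) =
      insert m (Finset.univ.filter (fun j : Fin (N + 1) => j < m)) := by
    ext j
    simp [le_iff_eq_or_lt]
  have hcard : (Finset.univ.filter (fun j : Fin (N + 1) => j < m)).card = i + 1 := by
    refine Eq.trans ?_ (Fin.card_Iio m)
    congr 1
    ext j
    simp
  rw [hfilter, Finset.sum_insert (by simp), Equiv.swap_self]
  have h1 : signOf (N + 1) (Equiv.refl _) = 1 := map_one _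
  rw [h1, one_mul, sub_eq_add_neg]
  congr 1
  rw [Finset.sum_congr rfl fun j hj => by
    rw [← mul_assoc, key j (Finset.mem_filter.1 hj).2], Finset.sum_const, hcard, smul_neg,
    Nat.cast_smul_eq_nsmul]

namespace VecBundle

variable {X : Type u} [TopologicalSpace X]

/-- The signed sum and the cycle live on complementary blocks of points, so the trace is a product.
The signed sum is `i!` times the antisymmetrizer of its block. -/
theorem trace_signSum_mul_cycleIcc (E : VecBundle.{u, v} X) {N i : ℕ} (hi : i < N + 1) :
    (E.symTensorPower (N + 1)).trace
      (signSum (N + 1) i * MonoidAlgebra.of ℂ _ (Fin.cycleIcc ⟨i, hi⟩ (Fin.last N))) =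
    (i.factorial : ℂ) • ((1 ⊗ₜ (E.extPower i).kclass) *
      (E.symTensorPower (N + 1 - i)).atiyahSegal (finRotate (N + 1 - i))) := by
  obtain ⟨j, rfl⟩ : ∃ j, N = i + j := ⟨N - i, by omega⟩
  have hj : i + j + 1 - i = j + 1 := by omega
  rw [hj, GVecBundle.atiyahSegal_eq_trace, ← trace_antisymmetrizer, trace_symTensorPower_mul,
    antisymmetrizer, map_smul, smul_mul_assoc, map_smul, smul_smul,
    mul_inv_cancel₀ (by exact_mod_cast i.factorial_ne_zero), one_smul, mapDomain_signSum,
    mapDomainAlgHom_of]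
  exact congrArg (fun σ => (E.symTensorPower (i + (j + 1))).trace
    (signSum (i + (j + 1)) i * MonoidAlgebra.of ℂ _ σ)) (permSum_finRotate i j hi).symm

/-- After division by `i!` the recursion reads `t_{i+1} = [Λ^{i+1} E] φ_{N-i} - t_i`, with `φ_k` the
value at the `k`-cycle, and unrolls to an alternating sum. -/
theorem trace_signSum_eq_sum (E : VecBundle.{u, v} X) {N i : ℕ} (hi : i < N + 1) :
    (E.symTensorPower (N + 1)).trace
      (signSum (N + 1) (i + 1) * MonoidAlgebra.of ℂ _ (Fin.cycleIcc ⟨i, hi⟩ (Fin.last N))) =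
    (i.factorial : ℂ) • ∑ l ∈ Finset.range (i + 1), (-1 : ℂ) ^ (i - l) •
      ((1 ⊗ₜ (E.extPower l).kclass) *
        (E.symTensorPower (N + 1 - l)).atiyahSegal (finRotate (N + 1 - l))) := by
  induction i with
  | zero =>
    have h := E.trace_signSum_mul_cycleIcc hi
    rw [signSum_of_le_one zero_le_one] at h
    rw [signSum_of_le_one le_rfl, h]
    simp
  | succ i ih =>
    rw [trace_signSum_succ_mul_cycleIcc _ (E.symTensorPower (N + 1)).trace_mul_comm hi, ih,
      E.trace_signSum_mul_cycleIcc hi, smul_smul, ← Nat.cast_mul, ← Nat.factorial_succ, ← smul_sub]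
    congr 1
    rw [Finset.sum_range_succ _ (i + 1), sub_eq_add_neg, add_comm, ← Finset.sum_neg_distrib,
      Nat.sub_self, pow_zero, one_smul]
    congr 1
    refine Finset.sum_congr rfl fun l hl => ?_
    rw [Nat.sub_add_comm (Nat.lt_succ_iff.1 (Finset.mem_range.1 hl)), pow_succ, mul_neg_one,
      neg_smul]

/-- Newton's identity for the traces of cycles on tensor powers. -/
theorem newton_atiyahSegal (E : VecBundle.{u, v} X) (N : ℕ) :
    ((N + 1 : ℕ) : ℂ) • (1 ⊗ₜ (E.extPower (N + 1)).kclass) =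
      ∑ l ∈ Finset.range (N + 1), (-1 : ℂ) ^ (N - l) • ((1 ⊗ₜ (E.extPower l).kclass) *
        (E.symTensorPower (N + 1 - l)).atiyahSegal (finRotate (N + 1 - l))) := by
  have h := E.trace_signSum_eq_sum (Nat.lt_succ_self N)
  have h0 : (N.factorial : ℂ) ≠ 0 := by exact_mod_cast N.factorial_ne_zero
  -- For `i = N` the cycle has a single point, and only the full antisymmetrizer remains. Its factor
  -- `(N + 1)!` against `N!` on the right leaves `N + 1`.
  have h1 : Fin.cycleIcc ⟨N, Nat.lt_succ_self N⟩ (Fin.last N) = 1 := Fin.cycleIcc_eq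
  have h2 : signSum (N + 1) (N + 1) = ((N + 1).factorial : ℂ) • antisymmetrizer (N + 1) := by
    rw [antisymmetrizer, smul_smul, mul_inv_cancel₀ (by exact_mod_cast (N + 1).factorial_ne_zero),
      one_smul]
  rw [h1, map_one, mul_one, h2, map_smul, trace_antisymmetrizer, Nat.factorial_succ, Nat.cast_mul,
    mul_comm, mul_smul] at h
  exact (IsUnit.mk0 _ h0).smul_left_cancel.1 h

/-- The term `l = 0` of Newton's identity is, up to sign, the value at the `n`-cycle. Solving for it
gives the recursion of `newtonPoly`. -/
theorem atiyahSegal_symTensorPower (E : VecBundle.{u, v} X) (n : ℕ) (hn : 1 ≤ n) :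
    (E.symTensorPower n).atiyahSegal (finRotate n) = (1 : ℂ) ⊗ₜ[ℤ] E.adams n := by
  induction n using Nat.strong_induction_on with
  | _ n ih =>
    obtain ⟨N, rfl⟩ : ∃ N, n = N + 1 := ⟨n - 1, by omega⟩
    have h := E.newton_atiyahSegal N
    rw [Finset.sum_range_succ', kclass_extPower_zero, ← Algebra.TensorProduct.one_def, one_mul,
      Nat.sub_zero, Nat.sub_zero] at h
    have hN : (-1 : ℂ) ^ N * (-1) ^ N = 1 := by rw [← mul_pow]; simp
    have h2 := congrArg (fun z => (-1 : ℂ) ^ N • z) h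
    simp only [smul_add, smul_smul, hN, one_smul] at h2
    rw [← sub_eq_iff_eq_add'] at h2
    rw [← h2, adams, newtonPoly, TensorProduct.tmul_add, TensorProduct.tmul_sum,
      sub_eq_add_neg, Finset.smul_sum, ← Finset.sum_neg_distrib, Fin.sum_univ_eq_sum_range
        (fun i => (1 : ℂ) ⊗ₜ[ℤ] ((-1) ^ i * (E.extPower (i + 1)).kclass *
          newtonPoly (fun k => (E.extPower k).kclass) (N - i)))]
    -- The coefficients of Newton's recursion are integers, hence move across the tensor product
    -- over `ℤ`.
    have hz : ∀ (k : ℤ) (z : KTheory.{u, v} X), (1 : ℂ) ⊗ₜ[ℤ] ((k : KTheory.{u, v} X) * z) =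
        (k : ℂ) • ((1 : ℂ) ⊗ₜ[ℤ] z) := by
      intro k z
      rw [← zsmul_eq_mul, TensorProduct.tmul_smul, Int.cast_smul_eq_zsmul]
    refine (add_comm _ _).trans ?_
    congr 1
    · refine Finset.sum_congr rfl fun i hi => ?_
      have hi' := Finset.mem_range.1 hi
      have h4 : N + 1 - (i + 1) = N - i := by omega
      rw [h4, ih (N - i) (by omega) (by omega), Algebra.TensorProduct.tmul_mul_tmul, one_mul,
        smul_smul, ← neg_smul]
      have h3 := hz ((-1) ^ i) ((E.extPower (i + 1)).kclass *
        newtonPoly (fun k => (E.extPower k).kclass) (N - i))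
      push_cast at h3
      rw [mul_assoc, h3]
      congr 1
      obtain ⟨j, rfl⟩ : ∃ j, N = i + 1 + j := ⟨N - (i + 1), by omega⟩
      have h5 : i + 1 + j - (i + 1) = j := by omega
      have hj : (-1 : ℂ) ^ j * (-1) ^ j = 1 := by rw [← mul_pow]; simp
      rw [h5, pow_add, pow_succ, mul_assoc, hj]
      ring
    · have h3 := hz ((-1) ^ N * (N + 1)) (E.extPower (N + 1)).kclass
      push_cast at h3
      rw [h3]
      push_cast
      rfl

end VecBundle

end

noncomputable section

/-! ### Adams operations of sums of line bundles -/

/-- The same recursion as for the classes of the exterior powers of `E ⊕ L`. -/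
theorem Multiset.esymm_cons_succ {R : Type*} [CommSemiring R] (a : R) (s : Multiset R) (k : ℕ) :
    (a ::ₘ s).esymm (k + 1) = s.esymm (k + 1) + s.esymm k * a := by
  simp only [Multiset.esymm, Multiset.powersetCard_cons, Multiset.map_add, Multiset.sum_add,
    Multiset.map_map, Function.comp_def, Multiset.prod_cons, Multiset.sum_map_mul_left]
  rw [mul_comm a]

/-- Newton's polynomials in the elementary symmetric functions are the power sums. -/
theorem newtonPoly_esymm {R : Type*} [CommRing R] {r : ℕ} (f : Fin r → R) {n : ℕ} (hn : 1 ≤ n) :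
    newtonPoly (fun k => MvPolynomial.aeval f (MvPolynomial.esymm (Fin r) ℤ k)) n =
      ∑ m, f m ^ n := by
  induction n using Nat.strong_induction_on with
  | _ n ih =>
    obtain ⟨N, rfl⟩ : ∃ N, n = N + 1 := ⟨n - 1, by omega⟩
    have h := congrArg (MvPolynomial.aeval f)
      (MvPolynomial.psum_eq_mul_esymm_sub_sum (Fin r) ℤ (N + 1) (Nat.succ_pos N))
    have h1 : ∀ k, MvPolynomial.aeval f (MvPolynomial.psum (Fin r) ℤ k) = ∑ m, f m ^ k := by
      intro k
      simp [MvPolynomial.psum]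
    -- Rewrites the index set of the polynomial Newton identity as the pairs `(i + 1, N - i)` with
    -- `i < N`, the form used in `newtonPoly`.
    have h2 : Finset.filter (fun a : ℕ × ℕ => a.1 ∈ Set.Ioo 0 (N + 1))
        (Finset.HasAntidiagonal.antidiagonal (N + 1)) = (Finset.range N).image (fun i => (i + 1, N - i)) := by
      ext ⟨a, b⟩
      simp only [Finset.mem_filter, Finset.HasAntidiagonal.mem_antidiagonal, Set.mem_Ioo, Finset.mem_image,
        Finset.mem_range, Prod.mk.injEq]
      constructor
      · rintro ⟨h3, h4, h5⟩
        exact ⟨a - 1, by omega, by omega, by omega⟩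
      · rintro ⟨i, h3, rfl, rfl⟩
        omega
    rw [h1, h2, Finset.sum_image fun i _ j _ hij => by simpa using (Prod.mk.inj hij).1] at h
    simp only [map_sub, map_mul, map_sum, map_pow, map_neg, map_one, map_natCast, h1] at h
    rw [h, newtonPoly, Fin.sum_univ_eq_sum_range (fun i => (-1) ^ i *
      MvPolynomial.aeval f (MvPolynomial.esymm (Fin r) ℤ (i + 1)) * newtonPoly
        (fun k => MvPolynomial.aeval f (MvPolynomial.esymm (Fin r) ℤ k)) (N - i)), add_comm,
      sub_eq_add_neg, ← Finset.sum_neg_distrib]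
    congr 1
    · rw [pow_succ, pow_succ]
      push_cast
      ring
    · refine Finset.sum_congr rfl fun i hi => ?_
      have hi' := Finset.mem_range.1 hi
      rw [ih (N - i) (by omega) (by omega), pow_succ]
      ring

namespace VecBundle

variable {X : Type u} [TopologicalSpace X]

theorem kclass_extPower_zero_succ (k : ℕ) :
    ((zero.{u, v} X).extPower (k + 1)).kclass = 0 := by
  have h : ∀ x, Subsingleton (((zero.{u, v} X).extPower (k + 1)).fiber x) := by
    intro x
    refine Module.finrank_zero_iff (R := ℂ) (M := ⋀[ℂ]^(k + 1) PUnit.{v + 1}) |>.1 ?_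
    rw [exteriorPower.finrank_eq, Module.finrank_zero_of_subsingleton, Nat.choose_zero_succ]
  have h' : ∀ x, Subsingleton ((zero.{u, v} X).fiber x) := fun _ =>
    inferInstanceAs (Subsingleton PUnit)
  have h1 : IsIso ((zero.{u, v} X).extPower (k + 1)) (zero X) :=
    isIso_of_bijective (isContHom_zero _ _) fun x =>
      ⟨fun a b _ => (h x).elim a b, fun a => ⟨0, (h' x).elim _ _⟩⟩
  exact h1.kclass_eq.trans (map_zero Algebra.GrothendieckAddGroup.of)

/-- Induction on the number of line bundles. The hypothesis is an equality of isomorphism classes,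
before group completion, so it yields actual isomorphisms, to which exterior powers can be applied.
-/
theorem kclass_extPower_of_sum {r : ℕ} (L : Fin r → VecBundle.{u, v} X)
    (hL : ∀ m, (L m).IsLineBundle) (E : VecBundle.{u, v} X)
    (hE : VectClass.mk E = ∑ m, VectClass.mk (L m)) (k : ℕ) :
    (E.extPower k).kclass =
      (Finset.univ.val.map (fun m => (L m).kclass)).esymm k := by
  induction r generalizing E k with
  | zero =>
    have h1 : IsIso E (zero X) := Quotient.exact hE
    rw [(isIso_extPower_congr h1 k).kclass_eq]
    cases k with
    | zero => simp [kclass_extPower_zero, Multiset.esymm]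
    | succ k => simp [kclass_extPower_zero_succ, Multiset.esymm, Multiset.powersetCard_zero_right]
  | succ r ih =>
    -- `F` represents the sum of all summands but the first.
    obtain ⟨F, hF⟩ : ∃ F, VectClass.mk F = ∑ m : Fin r, VectClass.mk (L m.succ) :=
      Quotient.exists_rep _
    rw [Fin.sum_univ_succ, add_comm, ← hF] at hE
    have h1 : IsIso E (directSum F (L 0)) := Quotient.exact hE
    rw [(isIso_extPower_congr h1 k).kclass_eq]
    cases k with
    | zero => simp [kclass_extPower_zero, Multiset.esymm]
    | succ k =>
      have hih := ih (fun m => L m.succ) (fun m => hL m.succ) F hF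
      rw [kclass_extPower_directSum _ _ (hL 0), hih, hih]
      simp only [Fin.univ_val_map, List.ofFn_succ, ← Multiset.cons_coe,
        Multiset.esymm_cons_succ]

theorem isIso_tensorPower_one (E : VecBundle.{u, v} X) : IsIso (E.tensorPower 1) E :=
  isIso_of_frame
    (fun x => PiTensorProduct.subsingletonEquiv (R := ℂ) (s := fun _ : Fin 1 => E.fiber x) 0)
    (fun _ => Equiv.funUnique (Fin 1) _) (fun _ => rfl)
    fun _ _ _ _ => PiTensorProduct.subsingletonEquiv_apply_tprod _ _

theorem kclass_tensorPower (E : VecBundle.{u, v} X) {n : ℕ} (hn : 1 ≤ n) :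
    (E.tensorPower n).kclass = E.kclass ^ n := by
  induction n, hn using Nat.le_induction with
  | base => rw [pow_one, E.isIso_tensorPower_one.kclass_eq]
  | succ n _ ih =>
    have h : IsIso (tensor (E.tensorPower n) (E.tensorPower 1)) (E.tensorPower (n + 1)) :=
      ⟨fun x => tensorPowerAdd (E.fiber x) n 1, E.isContHom_tensorPowerAdd n 1,
        E.isContHom_tensorPowerAdd_symm n 1⟩
    rw [← h.kclass_eq, kclass_tensor, ih, E.isIso_tensorPower_one.kclass_eq, pow_succ]

theorem adams_of_sum {r : ℕ} (L : Fin r → VecBundle.{u, v} X)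
    (hL : ∀ m, (L m).IsLineBundle) (E : VecBundle.{u, v} X)
    (hE : VectClass.mk E = ∑ m, VectClass.mk (L m)) {n : ℕ} (hn : 1 ≤ n) :
    E.adams n = ∑ m, ((L m).tensorPower n).kclass := by
  have h : (fun k => (E.extPower k).kclass) = fun k =>
      MvPolynomial.aeval (fun m => (L m).kclass) (MvPolynomial.esymm (Fin r) ℤ k) := by
    funext k
    rw [kclass_extPower_of_sum L hL E hE, MvPolynomial.aeval_esymm_eq_multiset_esymm]
  rw [adams, h, newtonPoly_esymm _ hn]
  exact Finset.sum_congr rfl fun m _ => ((L m).kclass_tensorPower hn).symm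

end VecBundle

end

/-- For a complex vector bundle `E` over `X` and `n ≥ 1`, the component at the `n`-cycle
`σ_n = finRotate n` of the Atiyah–Segal map sends `E^{⊗ n}` to `ψⁿ(E)`; here `ψⁿ(E)` is the `n`-th
Adams operation, which for a direct sum of line bundles is the sum of their `n`-th tensor powers. -/
theorem mainTheorem7 {X : Type u} [TopologicalSpace X] (E : VecBundle.{u, v} X) (n : ℕ)
    (hn : 1 ≤ n) :
    (E.symTensorPower n).atiyahSegal (finRotate n) = (1 : ℂ) ⊗ₜ[ℤ] E.adams n ∧
    ∀ (r : ℕ) (L : Fin r → VecBundle.{u, v} X), (∀ m, (L m).IsLineBundle) →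
      VectClass.mk E = ∑ m, VectClass.mk (L m) →
      E.adams n = ∑ m, ((L m).tensorPower n).kclass :=
  ⟨E.atiyahSegal_symTensorPower n hn, fun _ L hL hE => VecBundle.adams_of_sum L hL E hE hn⟩
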